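/- All actions of groups on metric spaces are isometric. A metric space is *hyperbolic* if it is geodesic and for some $\delta\ge 0$ every side of every geodesic triangle lies in the union of the closed $\delta$-neighbourhoods of the other two sides. An action of $G$ on a hyperbolic space $S$ is *cobounded* if $S=\bigcup_{g\in G}gB$ for some bounded $B\subseteq S$, and *quasi-parabolic* if its limit set $\Lambda(G)\subseteq\partial S$ in the Gromov boundary is infinite and $G$ fixes a point of $\partial S$. Write $\tau_{G\curvearrowright S}(g)=\lim_{n\to\infty}\frac1n\,\mathrm d_S(s,g^ns)$ for the translation number of $g\in G$. Two actions $G\curvearrowright R$, $G\curvearrowright S$ are *coarsely isospectral* if for every sequence $(g_i)_{i\in\mathbb N}$ in $G$, $$\lim_{i\to\infty}\tau_{G\curvearrowright R}(g_i)=\infty\iff\lim_{i\to\infty}\tau_{G\curvearrowright S}(g_i)=\infty ,$$ and *equivalent* if there is a quasi-isometry $f\colon R\to S$ such that $\sup_{g\in G}\mathrm d_S(f(gr),gf(r))<\infty$ for every $r\in R$. **Theorem.** Let $G$ be a group. 1. Let $G\curvearrowright R$ and $G\curvearrowright S$ be non-quasi-parabolic cobounded actions of $G$ on hyperbolic spaces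 $R$ and $S$. Then $G\curvearrowright R$ and $G\curvearrowright S$ are coarsely isospectral if and only if they are equivalent. 2. Coarsely isospectral acylindrically hyperbolic structures on $G$ coincide. Here two generating sets $X,Y$ of $G$ are identified if the identity map of $G$ is bi-Lipschitz with respect to the word metrics $\mathrm d_X$, $\mathrm d_Y$; an *acylindrically hyperbolic structure* is an equivalence class $[X]$ such that the Cayley graph $\Gamma(G,X)$ is hyperbolic and the action of $G$ on it is acylindrical (for every $\varepsilon$ there are $K,N$ such that for all points $x,y$ with $\mathrm d(x,y)\ge K$ at most $N$ elements $g\in G$ satisfy $\mathrm d(x,gx)\le\varepsilon$ and $\mathrm d(y,gy)\le\varepsilon$); and $[X]$, $[Y]$ are coarsely isospectral if the actions of $G$ on $\Gamma(G,X)$ and $\Gamma(G,Y)$ are. -/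

import Mathlib

open Set Filter Topology

namespace HypStr

universe u v w

/-! ## Isometric actions, coboundedness, equivalence -/

section Actions

variable (G : Type u) [Group G] (R : Type v) [MetricSpace R] [MulAction G R]
  (S : Type w) [MetricSpace S] [MulAction G S]

/-- There is a bounded subset whose translates cover the space. -/
def IsCobounded : Prop :=
  ∃ B : Set R, Bornology.IsBounded B ∧ (⋃ g : G, (fun x => g • x) '' B) = univ

variable {R S}

/-- A `C`-quasi-isometric embedding for some `C > 0` whose image is `C`-dense for the same `C`. -/
def IsQuasiIsometry (f : R → S) : Prop :=
  ∃ C : ℝ, 0 < C ∧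
    (∀ x y : R, 1 / C * dist x y - C ≤ dist (f x) (f y) ∧ dist (f x) (f y) ≤ C * dist x y + C) ∧
    ∀ y : S, ∃ x : R, dist y (f x) ≤ C

/-- For every `r`, the distances `d(f(gr), g f(r))` are bounded uniformly in `g`. -/
def IsCoarselyEquivariant (f : R → S) : Prop :=
  ∀ r : R, BddAbove (range fun g : G => dist (f (g • r)) (g • f r))

variable (R S)

/-- Two actions are equivalent if there is a coarsely equivariant quasi-isometry. -/
def AreEquivalent : Prop :=
  ∃ f : R → S, IsQuasiIsometry f ∧ IsCoarselyEquivariant G f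

/-- An acylindrical action. -/
def IsAcylindrical : Prop :=
  ∀ ε : ℝ, ∃ (K : ℝ) (N : ℕ), ∀ x y : R, K ≤ dist x y →
    {g : G | dist x (g • x) ≤ ε ∧ dist y (g • y) ≤ ε}.encard ≤ N

end Actions

/-! ## Translation numbers -/

section Translation

variable {G : Type u} [Group G] (R : Type v) [MetricSpace R] [MulAction G R]
  (S : Type w) [MetricSpace S] [MulAction G S]

/-- The translation number `lim d(s, gⁿ s) / n`; by `tendsto_translationNumber` below, the limit
exists and does not depend on `s`. -/
noncomputable def translationNumber [Nonempty R] (g : G) : ℝ :=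
  limUnder atTop fun n : ℕ =>
    dist (Classical.arbitrary R) (g ^ n • Classical.arbitrary R) / (n : ℝ)

theorem tendsto_translationNumber [IsIsometricSMul G R] [Nonempty R] (g : G) (s : R) :
    Tendsto (fun n : ℕ => dist s (g ^ n • s) / (n : ℝ)) atTop (𝓝 (translationNumber R g)) := by
  have key : ∀ x : R, ∃ t : ℝ,
      Tendsto (fun n : ℕ => dist x (g ^ n • x) / (n : ℝ)) atTop (𝓝 t) := by
    intro x
    have hsub : Subadditive fun n : ℕ => dist x (g ^ n • x) := by
      intro m n
      calc dist x (g ^ (m + n) • x)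
          ≤ dist x (g ^ m • x) + dist (g ^ m • x) (g ^ (m + n) • x) := dist_triangle _ _ _
        _ = dist x (g ^ m • x) + dist x (g ^ n • x) := by
          rw [pow_add, mul_smul, dist_smul]
    refine ⟨hsub.lim, hsub.tendsto_lim ⟨0, ?_⟩⟩
    rintro _ ⟨n, rfl⟩
    positivity
  obtain ⟨t, ht⟩ := key s
  have hlim : ∀ x : R, Tendsto (fun n : ℕ => dist x (g ^ n • x) / (n : ℝ)) atTop (𝓝 t) := by
    intro x
    have h0 : Tendsto (fun n : ℕ => (2 * dist s x) / (n : ℝ)) atTop (𝓝 0) :=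
      tendsto_const_div_atTop_nhds_zero_nat _
    refine ht.congr_dist (squeeze_zero (fun _ => dist_nonneg) (fun n => ?_) h0)
    rw [Real.dist_eq, ← sub_div, abs_div, abs_of_nonneg (Nat.cast_nonneg n : (0 : ℝ) ≤ n)]
    gcongr
    have h1 := dist_triangle4 s x (g ^ n • x) (g ^ n • s)
    have h2 := dist_triangle4 x s (g ^ n • s) (g ^ n • x)
    rw [dist_smul] at h1 h2
    rw [dist_comm x s] at h1 h2
    rw [abs_le]
    constructor <;> linarith
  have : translationNumber R g = t := (hlim (Classical.arbitrary R)).limUnder_eq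
  rw [this]
  exact ht

variable (G)

/-- Translation numbers tend to infinity along exactly the same sequences of elements. -/
def AreCoarselyIsospectral [Nonempty R] [Nonempty S] : Prop :=
  ∀ g : ℕ → G, Tendsto (fun i => translationNumber R (g i)) atTop atTop ↔
    Tendsto (fun i => translationNumber S (g i)) atTop atTop

end Translation

/-! ## Hyperbolic spaces, Gromov boundary, quasi-parabolic actions -/

section Hyperbolic

variable (S : Type v) [MetricSpace S]

variable {S} in
/-- `A` is (the image of) a geodesic segment joining `x` and `y`. -/
def IsGeodesicSegment (x y : S) (A : Set S) : Prop :=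
  ∃ γ : ℝ → S, γ 0 = x ∧ γ (dist x y) = y ∧
    (∀ s ∈ Icc 0 (dist x y), ∀ t ∈ Icc 0 (dist x y), dist (γ s) (γ t) = |s - t|) ∧
    A = γ '' Icc 0 (dist x y)

/-- A geodesic metric space all of whose geodesic triangles are `δ`-slim, for a uniform `δ`. -/
def IsHyperbolic : Prop :=
  (∀ x y : S, ∃ A, IsGeodesicSegment x y A) ∧
  ∃ δ : ℝ, 0 ≤ δ ∧ ∀ (x y z : S) (A B C : Set S),
    IsGeodesicSegment x y A → IsGeodesicSegment y z B → IsGeodesicSegment x z C →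
      ∀ p ∈ A, ∃ q ∈ B ∪ C, dist p q ≤ δ

variable {S}

noncomputable def gromovProduct (z x y : S) : ℝ :=
  (dist x z + dist y z - dist x y) / 2

/-- `(x_i | y_j)_s → ∞` as `i, j → ∞` (for every base point `s`; equivalently, for one). -/
def ProductTendsto (x y : ℕ → S) : Prop :=
  ∀ s : S, Tendsto (fun p : ℕ × ℕ => gromovProduct s (x p.1) (y p.2)) atTop atTop

variable (S) in
/-- Sequences converging at infinity. -/
def ConvSeq : Type v := {x : ℕ → S // ProductTendsto x x}

variable (S) in
/-- The Gromov boundary: sequences converging at infinity, where `x` and `y` are identified if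
`(x_i | y_j) → ∞`. On a hyperbolic space this is an equivalence relation. -/
def GromovBoundary : Type v := Quot fun x y : ConvSeq S => ProductTendsto x.1 y.1

variable {G : Type u} [Group G] [MulAction G S] [IsIsometricSMul G S]

theorem ProductTendsto.smul {x y : ℕ → S} (h : ProductTendsto x y) (g : G) :
    ProductTendsto (fun i => g • x i) (fun i => g • y i) := by
  intro s
  have e : ∀ a b : S, gromovProduct s (g • a) (g • b) = gromovProduct (g⁻¹ • s) a b := by
    intro a b
    have h1 : ∀ a : S, dist (g • a) s = dist a (g⁻¹ • s) := fun a => by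
      rw [← dist_smul g a (g⁻¹ • s), smul_inv_smul]
    simp only [gromovProduct, dist_smul, h1]
  simpa only [e] using h (g⁻¹ • s)

/-- The action on the boundary induced by an isometric action. -/
def boundaryMap (g : G) : GromovBoundary S → GromovBoundary S :=
  Quot.map (fun x => ⟨fun i => g • x.1 i, x.2.smul g⟩) fun _ _ h => h.smul g

end Hyperbolic

section QuasiParabolic

variable (G : Type u) [Group G] (S : Type v) [MetricSpace S] [MulAction G S] [IsIsometricSMul G S]

/-- The limit set: the boundary points to which some sequence of points of a `G`-orbit
converges. -/
def limitSet : Set (GromovBoundary S) :=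
  {ξ | ∃ (s : S) (g : ℕ → G) (h : ProductTendsto (fun i => g i • s) (fun i => g i • s)),
    ξ = Quot.mk _ ⟨fun i => g i • s, h⟩}

/-- The limit set is infinite and `G` fixes a point of the boundary. -/
def IsQuasiParabolic : Prop :=
  (limitSet G S).Infinite ∧ ∃ ξ : GromovBoundary S, ∀ g : G, boundaryMap g ξ = ξ

end QuasiParabolic

/-! ## The geometric realization of a connected graph -/

section Realization

variable {V : Type u} (Γ : SimpleGraph V)

open Classical in
/-- In barycentric coordinates, `p` lies on the closed edge with endpoints `u`, `v`, or `u = v`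
and `p` is this vertex. -/
def OnEdge (p : V → ℝ) (u v : V) : Prop :=
  (u = v ∨ Γ.Adj u v) ∧ p ∈ segment ℝ (Pi.single u (1 : ℝ)) (Pi.single v (1 : ℝ))

/-- The points of the geometric realization, in barycentric coordinates. -/
structure Realization where
  coord : V → ℝ
  onEdge : ∃ u v, OnEdge Γ coord u v

/-- Lengths of the standard paths from `p` to `q`, all edges having length `1`: the segment between
two points of a common closed edge, and the path from `p` along an edge to an endpoint `u`, then
along a shortest edge path from `u` to `v`, then along an edge from its endpoint `v` to `q`. -/
inductive PathLength (p q : V → ℝ) : ℝ → Prop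
  | edge (u v : V) (hp : OnEdge Γ p u v) (hq : OnEdge Γ q u v) : PathLength p q |p u - q u|
  | via (u u' v v' : V) (hp : OnEdge Γ p u u') (hq : OnEdge Γ q v v') :
      PathLength p q ((1 - p u) + Γ.dist u v + (1 - q v))

variable {Γ}

theorem OnEdge.symm {p : V → ℝ} {u v : V} (h : OnEdge Γ p u v) : OnEdge Γ p v u :=
  ⟨h.1.imp Eq.symm fun h' => h'.symm, by rw [segment_symm]; exact h.2⟩

theorem OnEdge.spec {p : V → ℝ} {u v : V} (h : OnEdge Γ p u v) :
    0 ≤ p u ∧ 0 ≤ p v ∧ p u ≤ 1 ∧ p v ≤ 1 ∧ (u = v → p u = 1) ∧ (u ≠ v → p u + p v = 1) ∧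
      ∀ x, x ≠ u → x ≠ v → p x = 0 := by
  classical
  obtain ⟨-, a, b, ha, hb, hab, rfl⟩ := h
  simp only [Pi.add_apply, Pi.smul_apply, Pi.single_apply, smul_eq_mul]
  by_cases huv : u = v
  · subst huv
    simp +contextual [hab]
  · have hvu : v ≠ u := fun h => huv h.symm
    simp +contextual [huv, hvu, ha, hb, hab]
    constructor <;> linarith

theorem OnEdge.le_one {p : V → ℝ} {u v : V} (h : OnEdge Γ p u v) (x : V) :
    0 ≤ p x ∧ p x ≤ 1 := by
  obtain ⟨h1, h2, h3, h4, -, -, h7⟩ := h.spec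
  by_cases hu : x = u
  · subst hu; exact ⟨h1, h3⟩
  · by_cases hv : x = v
    · subst hv; exact ⟨h2, h4⟩
    · rw [h7 x hu hv]; norm_num

theorem OnEdge.abs_eq {p q : V → ℝ} {u v : V} (hp : OnEdge Γ p u v) (hq : OnEdge Γ q u v) :
    |p u - q u| = |p v - q v| := by
  obtain ⟨-, -, -, -, -, h6, -⟩ := hp.spec
  obtain ⟨-, -, -, -, -, k6, -⟩ := hq.spec
  by_cases huv : u = v
  · rw [huv]
  · rw [show p u - q u = -(p v - q v) by linarith [h6 huv, k6 huv], abs_neg]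

theorem OnEdge.add_le_one {p : V → ℝ} {u v : V} (h : OnEdge Γ p u v) {x y : V} (hxy : x ≠ y) :
    p x + p y ≤ 1 := by
  obtain ⟨h1, h2, h3, h4, -, h6, h7⟩ := h.spec
  by_cases hxu : x = u <;> by_cases hxv : x = v <;> by_cases hyu : y = u <;>
    by_cases hyv : y = v <;> grind

theorem PathLength.symm {p q : V → ℝ} {r : ℝ} (h : PathLength Γ p q r) : PathLength Γ q p r := by
  cases h with
  | edge u v hp hq => rw [abs_sub_comm]; exact .edge u v hq hp
  | via u u' v v' hp hq =>
    have := PathLength.via v v' u u' hq hp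
    rw [SimpleGraph.dist_comm] at this
    convert this using 1
    ring

theorem PathLength.coord_le (hΓ : Γ.Connected) {p q : V → ℝ} {r : ℝ} (h : PathLength Γ p q r)
    (w : V) : |p w - q w| ≤ r := by
  cases h with
  | edge u v hp hq =>
    by_cases hu : w = u
    · rw [hu]
    · by_cases hv : w = v
      · rw [hv, hp.abs_eq hq]
      · rw [hp.spec.2.2.2.2.2.2 w hu hv, hq.spec.2.2.2.2.2.2 w hu hv]
        simp
  | via u u' v v' hp hq =>
    have a1 := hp.le_one w
    have a2 := hq.le_one w
    have a3 := hp.le_one u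
    have a4 := hq.le_one v
    rw [abs_le]
    by_cases huv : u = v
    · subst huv
      by_cases hw : w = u
      · subst hw
        simp only [SimpleGraph.dist_self, Nat.cast_zero]
        constructor <;> linarith
      · have b1 := hp.add_le_one hw
        have b2 := hq.add_le_one hw
        simp only [SimpleGraph.dist_self, Nat.cast_zero]
        constructor <;> linarith
    · have : (1 : ℝ) ≤ Γ.dist u v := by exact_mod_cast hΓ.pos_dist_of_ne huv
      constructor <;> linarith

theorem PathLength.nonneg (hΓ : Γ.Connected) {p q : V → ℝ} {r : ℝ} (h : PathLength Γ p q r) :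
    0 ≤ r := by
  obtain ⟨w⟩ := hΓ.nonempty
  exact (abs_nonneg _).trans (h.coord_le hΓ w)

theorem PathLength.edge_via (hΓ : Γ.Connected) {p q r : V → ℝ} {u v x x' y y' : V}
    (hp : OnEdge Γ p u v) (hq : OnEdge Γ q u v) (hq' : OnEdge Γ q x x') (hr : OnEdge Γ r y y') :
    ∃ c ≤ |p u - q u| + ((1 - q x) + Γ.dist x y + (1 - r y)), PathLength Γ p r c := by
  have e := hp.abs_eq hq
  by_cases hxu : x = u
  · subst hxu
    exact ⟨_, by linarith [neg_abs_le (p x - q x)], .via x v y y' hp hr⟩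
  by_cases hxv : x = v
  · subst hxv
    exact ⟨_, by linarith [neg_abs_le (p x - q x)], .via x u y y' hp.symm hr⟩
  have hx0 := hq.spec.2.2.2.2.2.2 x hxu hxv
  have hxx : x ≠ x' := fun h => by have := hq'.spec.2.2.2.2.1 h; linarith
  have hx1 : q x' = 1 := by have := hq'.spec.2.2.2.2.2.1 hxx; linarith
  have hadj : Γ.Adj x x' := hq'.1.resolve_left hxx
  have hd : (Γ.dist x' y : ℝ) ≤ 1 + Γ.dist x y := by
    have := hΓ.dist_triangle (u := x') (v := x) (w := y)
    rw [SimpleGraph.dist_eq_one_iff_adj.2 hadj.symm] at this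
    exact_mod_cast this
  by_cases hu : x' = u
  · subst hu
    exact ⟨_, by linarith [neg_abs_le (p x' - q x')], .via x' v y y' hp hr⟩
  by_cases hv : x' = v
  · subst hv
    exact ⟨_, by linarith [neg_abs_le (p x' - q x')], .via x' u y y' hp.symm hr⟩
  have := hq.spec.2.2.2.2.2.2 x' hu hv
  linarith

theorem PathLength.trans (hΓ : Γ.Connected) {p q r : V → ℝ} {a b : ℝ}
    (h1 : PathLength Γ p q a) (h2 : PathLength Γ q r b) : ∃ c ≤ a + b, PathLength Γ p r c := by
  cases h1 with
  | edge u v hp hq =>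
    cases h2 with
    | via x x' y y' hq' hr => exact PathLength.edge_via hΓ hp hq hq' hr
    | edge u' v' hq' hr =>
      have aux : ∀ {u v u' v' : V}, OnEdge Γ p u v → OnEdge Γ q u v → OnEdge Γ q u' v' →
          OnEdge Γ r u' v' → q u = 1 →
          ∃ c ≤ |p u - q u| + |q u' - r u'|, PathLength Γ p r c := by
        intro u v u' v' hp hq hq' hr h1
        have e := hq'.abs_eq hr
        have hmem : u = u' ∨ u = v' := by
          by_contra! hc
          have := hq'.spec.2.2.2.2.2.2 u hc.1 hc.2
          linarith
        rcases hmem with rfl | rfl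
        · refine ⟨_, ?_, .via u v u v' hp hr⟩
          simp only [SimpleGraph.dist_self, Nat.cast_zero]
          linarith [neg_abs_le (p u - q u), le_abs_self (q u - r u)]
        · refine ⟨_, ?_, .via u v u u' hp hr.symm⟩
          simp only [SimpleGraph.dist_self, Nat.cast_zero]
          linarith [neg_abs_le (p u - q u), le_abs_self (q u - r u)]
      by_cases hu1 : q u = 1
      · exact aux hp hq hq' hr hu1
      by_cases hv1 : q v = 1
      · rw [hp.abs_eq hq]
        exact aux hp.symm hq.symm hq' hr hv1
      have huv : u ≠ v := fun h => hu1 (hq.spec.2.2.2.2.1 h)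
      have hs := hq.spec.2.2.2.2.2.1 huv
      have hmu : u = u' ∨ u = v' := by
        by_contra! hc
        have := hq'.spec.2.2.2.2.2.2 u hc.1 hc.2
        exact hv1 (by linarith)
      have hmv : v = u' ∨ v = v' := by
        by_contra! hc
        have := hq'.spec.2.2.2.2.2.2 v hc.1 hc.2
        exact hu1 (by linarith)
      have hr' : OnEdge Γ r u v ∧ |q u' - r u'| = |q u - r u| := by
        rcases hmu with rfl | rfl <;> rcases hmv with rfl | rfl
        · exact absurd rfl huv
        · exact ⟨hr, rfl⟩
        · exact ⟨hr.symm, hq'.abs_eq hr⟩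
        · exact absurd rfl huv
      rw [hr'.2]
      exact ⟨_, abs_sub_le _ _ _, .edge u v hp hr'.1⟩
  | via u u' x x' hp hq =>
    cases h2 with
    | edge y y' hq' hr =>
      obtain ⟨c, hc, h⟩ := PathLength.edge_via hΓ hr hq' hq hp
      refine ⟨c, ?_, h.symm⟩
      rw [SimpleGraph.dist_comm, abs_sub_comm] at hc
      linarith
    | via y y' v v' hq' hr =>
      refine ⟨_, ?_, .via u u' v v' hp hr⟩
      have hd : (Γ.dist u v : ℝ) ≤ Γ.dist u x + Γ.dist x y + Γ.dist y v := by
        have t1 := hΓ.dist_triangle (u := u) (v := x) (w := v)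
        have t2 := hΓ.dist_triangle (u := x) (v := y) (w := v)
        exact_mod_cast (by omega : Γ.dist u v ≤ Γ.dist u x + Γ.dist x y + Γ.dist y v)
      suffices (Γ.dist x y : ℝ) ≤ (1 - q x) + (1 - q y) by linarith
      by_cases hxy : x = y
      · subst hxy
        have := hq.le_one x
        simp only [SimpleGraph.dist_self, Nat.cast_zero]
        linarith
      have hsum := hq.add_le_one hxy
      by_cases hadj : Γ.Adj x y
      · rw [SimpleGraph.dist_eq_one_iff_adj.2 hadj]
        push_cast
        linarith
      have hyx' : y ≠ x' := fun h => by
        subst h; exact hadj (hq.1.resolve_left hxy)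
      have hxy' : x ≠ y' := fun h => by
        subst h; exact hadj (hq'.1.resolve_left (Ne.symm hxy)).symm
      have qy : q y = 0 := hq.spec.2.2.2.2.2.2 y (Ne.symm hxy) hyx'
      have qx : q x = 0 := hq'.spec.2.2.2.2.2.2 x hxy hxy'
      have hxx : x ≠ x' := fun h => by have := hq.spec.2.2.2.2.1 h; linarith
      have hyy : y ≠ y' := fun h => by have := hq'.spec.2.2.2.2.1 h; linarith
      have qx' : q x' = 1 := by have := hq.spec.2.2.2.2.2.1 hxx; linarith
      have hx'y' : x' = y' := by
        by_contra hc
        have := hq'.spec.2.2.2.2.2.2 x' (Ne.symm hyx') hc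
        linarith
      have d1 := SimpleGraph.dist_eq_one_iff_adj.2 (hq.1.resolve_left hxx)
      have d2 := SimpleGraph.dist_eq_one_iff_adj.2 (hq'.1.resolve_left hyy).symm
      rw [← hx'y'] at d2
      have t := hΓ.dist_triangle (u := x) (v := x') (w := y)
      have : (Γ.dist x y : ℝ) ≤ 2 := by exact_mod_cast (by omega : Γ.dist x y ≤ 2)
      linarith

theorem Realization.ext' {p q : Realization Γ} (h : p.coord = q.coord) : p = q := by
  cases p; cases q; cases h; rfl

theorem Realization.exists_pathLength (p q : Realization Γ) :
    ∃ r, PathLength Γ p.coord q.coord r := by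
  obtain ⟨u, u', hp⟩ := p.onEdge
  obtain ⟨v, v', hq⟩ := q.onEdge
  exact ⟨_, .via u u' v v' hp hq⟩

variable (Γ) in
/-- The path metric on the realization of a connected graph. -/
@[reducible] noncomputable def Realization.metricSpace (hΓ : Γ.Connected) :
    MetricSpace (Realization Γ) where
  dist p q := sInf {r | PathLength Γ p.coord q.coord r}
  dist_self p := by
    obtain ⟨u, v, hp⟩ := p.onEdge
    refine le_antisymm (csInf_le ⟨0, fun r hr => hr.nonneg hΓ⟩ ?_)
      (Real.sInf_nonneg fun r hr => PathLength.nonneg hΓ hr)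
    have := PathLength.edge u v hp hp
    simpa using this
  dist_comm p q := by
    congr 1
    ext r
    exact ⟨fun h => PathLength.symm h, fun h => PathLength.symm h⟩
  dist_triangle p q r := by
    have h1 : ∀ a ∈ {a | PathLength Γ p.coord q.coord a},
        ∀ b ∈ {b | PathLength Γ q.coord r.coord b},
        sInf {c | PathLength Γ p.coord r.coord c} ≤ a + b := by
      intro a ha b hb
      obtain ⟨c, hc, h⟩ := PathLength.trans hΓ ha hb
      exact (csInf_le ⟨0, fun r hr => hr.nonneg hΓ⟩ h).trans hc
    have h2 : ∀ a ∈ {a | PathLength Γ p.coord q.coord a},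
        sInf {c | PathLength Γ p.coord r.coord c} - a ≤
          sInf {b | PathLength Γ q.coord r.coord b} := fun a ha =>
      le_csInf (q.exists_pathLength r) fun b hb => by linarith [h1 a ha b hb]
    have h3 : sInf {c | PathLength Γ p.coord r.coord c} -
        sInf {b | PathLength Γ q.coord r.coord b} ≤ sInf {a | PathLength Γ p.coord q.coord a} :=
      le_csInf (p.exists_pathLength q) fun a ha => by linarith [h2 a ha]
    linarith
  eq_of_dist_eq_zero {p q} h := by
    refine Realization.ext' (funext fun x => ?_)
    have : |p.coord x - q.coord x| ≤ 0 := by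
      rw [← h]
      exact le_csInf (p.exists_pathLength q) fun r hr => PathLength.coord_le hΓ hr x
    exact sub_eq_zero.1 (abs_nonpos_iff.1 this)

end Realization

/-! ## Generating sets and Cayley graphs -/

section Cayley

variable (G : Type u) [Group G]

/-- Generating sets of `G`. -/
def GenSet : Type u := {X : Set G // Subgroup.closure X = ⊤}

variable {G}

/-- The Cayley graph as a combinatorial graph. -/
def GenSet.graph (X : GenSet G) : SimpleGraph G := SimpleGraph.mulCayley X.1

/-- The word metric. -/
noncomputable def GenSet.wordDist (X : GenSet G) (g h : G) : ℕ := X.graph.dist g h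

theorem GenSet.adj_mul (X : GenSet G) (a g h : G) :
    X.graph.Adj (a * g) (a * h) ↔ X.graph.Adj g h :=
  SimpleGraph.mulCayley_adj_mul_iff_right

theorem GenSet.connected (X : GenSet G) : X.graph.Connected := by
  have key : ∀ g : G, X.graph.Reachable 1 g := by
    intro g
    have hg : g ∈ Subgroup.closure X.1 := by rw [X.2]; trivial
    have tr : ∀ (a : G) {x y : G}, X.graph.Reachable x y → X.graph.Reachable (a * x) (a * y) := by
      intro a x y h
      exact h.map (⟨fun z => a * z, fun h => (X.adj_mul a _ _).2 h⟩ : X.graph →g X.graph)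
    induction hg using Subgroup.closure_induction with
    | mem x hx =>
      by_cases h1 : (1 : G) = x
      · rw [h1]
      · exact SimpleGraph.Adj.reachable
          ((SimpleGraph.mulCayley_adj' _ _ _).2 ⟨h1, x, hx, Or.inl (one_mul x)⟩)
    | one => exact SimpleGraph.Reachable.refl _
    | mul x y _ _ hx hy =>
      have := tr x hy
      rw [mul_one] at this
      exact hx.trans this
    | inv x _ hx =>
      have := tr x⁻¹ hx
      rw [mul_one, inv_mul_cancel] at this
      exact this.symm
  have : Nonempty G := ⟨1⟩
  exact ⟨fun g h => (key g).symm.trans (key h)⟩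

theorem GenSet.dist_mul_le (X : GenSet G) (a g h : G) :
    X.graph.dist (a * g) (a * h) ≤ X.graph.dist g h := by
  obtain ⟨w, hw⟩ := X.connected.exists_walk_length_eq_dist g h
  rw [← hw]
  have := SimpleGraph.dist_le
    (w.map (⟨fun z => a * z, fun h => (X.adj_mul a _ _).2 h⟩ : X.graph →g X.graph))
  rwa [SimpleGraph.Walk.length_map] at this

theorem GenSet.dist_mul (X : GenSet G) (a g h : G) :
    X.graph.dist (a * g) (a * h) = X.graph.dist g h := by
  refine le_antisymm (X.dist_mul_le a g h) ?_
  simpa using X.dist_mul_le a⁻¹ (a * g) (a * h)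

/-- The Cayley graph as a metric space: the geometric realization with its path metric. -/
def CayleyGraph (X : GenSet G) : Type u := Realization X.graph

noncomputable instance (X : GenSet G) : MetricSpace (CayleyGraph X) :=
  Realization.metricSpace X.graph X.connected

open Classical in
instance (X : GenSet G) : Nonempty (CayleyGraph X) :=
  ⟨⟨Pi.single 1 1, 1, 1, Or.inl rfl, left_mem_segment _ _ _⟩⟩

theorem OnEdge.translate {X : GenSet G} {p : G → ℝ} {u v : G} (h : OnEdge X.graph p u v) (a : G) :
    OnEdge X.graph (fun x => p (a⁻¹ * x)) (a * u) (a * v) := by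
  classical
  refine ⟨h.1.imp (fun h => by rw [h]) fun h => (X.adj_mul a _ _).2 h, ?_⟩
  obtain ⟨-, s, t, hs, ht, hst, rfl⟩ := h
  refine ⟨s, t, hs, ht, hst, funext fun x => ?_⟩
  simp [Pi.single_apply, inv_mul_eq_iff_eq_mul]

/-- The natural action of `G` on its Cayley graph by left translation: the vertex `g` is sent to
`a * g`, and the map is affine on edges. -/
instance (X : GenSet G) : MulAction G (CayleyGraph X) where
  smul a p := ⟨fun x => p.coord (a⁻¹ * x), by
    obtain ⟨u, v, h⟩ := p.onEdge
    exact ⟨a * u, a * v, h.translate a⟩⟩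
  one_smul p := Realization.ext' (funext fun x => by
    change p.coord (1⁻¹ * x) = p.coord x
    simp)
  mul_smul a b p := Realization.ext' (funext fun x => by
    change p.coord ((a * b)⁻¹ * x) = p.coord (b⁻¹ * (a⁻¹ * x))
    simp [mul_assoc])

theorem CayleyGraph.smul_coord {X : GenSet G} (a : G) (p : CayleyGraph X) :
    Realization.coord (a • p : CayleyGraph X) = fun x => Realization.coord p (a⁻¹ * x) := rfl

theorem PathLength.translate {X : GenSet G} {p q : G → ℝ} {r : ℝ} (h : PathLength X.graph p q r)
    (a : G) : PathLength X.graph (fun x => p (a⁻¹ * x)) (fun x => q (a⁻¹ * x)) r := by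
  cases h with
  | edge u v hp hq =>
    have := PathLength.edge (a * u) (a * v) (hp.translate a) (hq.translate a)
    simpa using this
  | via u u' v v' hp hq =>
    have := PathLength.via (a * u) (a * u') (a * v) (a * v') (hp.translate a) (hq.translate a)
    simpa [X.dist_mul] using this

instance (X : GenSet G) : IsIsometricSMul G (CayleyGraph X) where
  isometry_smul a := Isometry.of_dist_eq fun p q => by
    change sInf {r | PathLength X.graph _ _ r} = sInf {r | PathLength X.graph _ _ r}
    congr 1
    ext r
    refine ⟨fun h => ?_, fun h => PathLength.translate h a⟩
    have := PathLength.translate h a⁻¹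
    simpa [CayleyGraph.smul_coord] using this

end Cayley

/-! ## Structures on a group -/

section Structures

variable (G : Type u) [Group G]

/-- `X ⪯ Y`: the identity map `(G, d_Y) → (G, d_X)` is Lipschitz. -/
def GenSet.Dominated {G : Type u} [Group G] (X Y : GenSet G) : Prop :=
  ∃ K : ℕ, ∀ g h : G, X.wordDist g h ≤ K * Y.wordDist g h

/-- Equivalence of generating sets: domination both ways. -/
instance GenSet.setoid : Setoid (GenSet G) where
  r X Y := X.Dominated Y ∧ Y.Dominated X
  iseqv := by
    have tr : ∀ {X Y Z : GenSet G}, X.Dominated Y → Y.Dominated Z → X.Dominated Z := by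
      rintro X Y Z ⟨K, hK⟩ ⟨L, hL⟩
      refine ⟨K * L, fun g h => (hK g h).trans ?_⟩
      rw [mul_assoc]
      exact Nat.mul_le_mul_left K (hL g h)
    exact ⟨fun X => ⟨⟨1, fun g h => by simp⟩, ⟨1, fun g h => by simp⟩⟩, fun h => ⟨h.2, h.1⟩,
      fun h k => ⟨tr h.1 k.1, tr k.2 h.2⟩⟩

/-- Equivalence classes `[X]` of generating sets of `G`. -/
def GenClass : Type u := Quotient (GenSet.setoid G)

variable {G} in
def GenSet.toClass (X : GenSet G) : GenClass G := Quotient.mk (GenSet.setoid G) X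

/-- Acylindrically hyperbolic structures: the classes `[X]` such that the Cayley graph of `G` with
respect to `X` is hyperbolic and the action of `G` on it is acylindrical. -/
def acylindricallyHyperbolicStructures : Set (GenClass G) :=
  {A | ∃ X : GenSet G, X.toClass = A ∧ IsHyperbolic (CayleyGraph X) ∧
    IsAcylindrical G (CayleyGraph X)}

variable {G} in
/-- Coarse isospectrality of classes of generating sets, through the actions on the Cayley graphs
of representatives. -/
def GenClass.AreCoarselyIsospectral (A B : GenClass G) : Prop :=
  ∃ X Y : GenSet G, X.toClass = A ∧ Y.toClass = B ∧
    HypStr.AreCoarselyIsospectral G (CayleyGraph X) (CayleyGraph Y)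

end Structures

end HypStr

/-! A translation number never exceeds a displacement, but can be much smaller. The crux is that,
under the hypotheses of either part, the gap can be closed by a finite set: there are a finite `F ⊆
G` and a constant `M` such that every `g` has some `f ∈ F` with `τ(g f) ≥ d(s, g s) - M`
(`exists_finset_le_translationNumber`). Suppose the actions are isospectral, and some `g i` have
bounded displacement in `R` but unbounded displacement in `S`. Correcting each `g i` by an element
of `F` sends the translation numbers in `S` to infinity while those in `R` stay bounded, a
contradiction. So bounded displacement in one space forces bounded displacement in the other.
Cutting geodesics into unit pieces, as in the Milnor–Schwarz argument, upgrades this to linear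
bounds both ways, and then matching orbit points is an equivalence. The converse is easy: linear
bounds on displacements pass to translation numbers.

To find `F`, note that `τ(g)` is close to `d(s, g s)` as soon as `(g s | g⁻¹ s)_s` is small compared
with it (`IsAxial`), so some `f ∈ F` should make `(g s | f g⁻¹ s)_s` bounded. An unbounded cobounded
action has a loxodromic `h`. If all of `G` fixes both endpoints of `h`, every element acts as a
coarse translation and no correction is needed. If `f₁` moves one endpoint and `f₂` the other, `F =
{1, h, f₁, f₂}` works: should every choice fail, `h` would almost fix the direction of `g⁻¹ s`,
which is then near an endpoint of `h`, and this endpoint would be almost fixed by `f₁` and `f₂`.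

The remaining case, exactly one endpoint fixed by `G`, is excluded by `FixesBothEnds`, the only
property the two parts feed into the common argument. If the action is not quasi-parabolic, it holds
because a moved repelling endpoint would have infinitely many images in the limit set. If the action
is acylindrical, an element fixing one endpoint of `h` commutes with a power of `h`, hence fixes the
other. In the second part, displacement of the vertex `1` is word length, so equivalence of the
actions says that the generating sets are bi-Lipschitz equivalent. -/

namespace HypStr

universe u v w

/-! ## Gromov products and the four-point condition -/

section FourPoint

variable {S : Type v} [MetricSpace S]

/-- Gromov's four-point condition. -/
def FourPoint (S : Type v) [MetricSpace S] (δ : ℝ) : Prop :=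
  0 ≤ δ ∧ ∀ w x y z : S,
    min (gromovProduct w x y) (gromovProduct w y z) ≤ gromovProduct w x z + δ

theorem gromovProduct_comm (w x y : S) : gromovProduct w x y = gromovProduct w y x := by
  simp only [gromovProduct, dist_comm x y]; ring

theorem gromovProduct_nonneg (w x y : S) : 0 ≤ gromovProduct w x y := by
  have := dist_triangle_right x y w
  simp only [gromovProduct]; linarith

theorem gromovProduct_self_left (w x : S) : gromovProduct w w x = 0 := by
  simp [gromovProduct, dist_comm]

theorem gromovProduct_self_right (w x : S) : gromovProduct w x w = 0 := by
  simp [gromovProduct, dist_comm]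

theorem gromovProduct_le_left (w x y : S) : gromovProduct w x y ≤ dist w x := by
  have := dist_triangle y x w
  simp only [gromovProduct, dist_comm w x, dist_comm x y]; linarith

/-- The main exchange device below: a product that is small at `x` is nearly maximal at `w`. -/
theorem gromovProduct_add_swap (w x y : S) :
    gromovProduct w x y + gromovProduct x w y = dist w x := by
  simp only [gromovProduct, dist_comm w x, dist_comm w y, dist_comm x y]; ring

theorem gromovProduct_base_le (w w' x y : S) :
    gromovProduct w x y ≤ gromovProduct w' x y + dist w w' := by
  have h1 := dist_triangle x w' w
  have h2 := dist_triangle y w' w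
  simp only [gromovProduct, dist_comm w w']; linarith

theorem gromovProduct_le_add_dist (w x x' y : S) :
    gromovProduct w x y ≤ gromovProduct w x' y + dist x x' := by
  have h1 := dist_triangle x x' w
  have h2 := dist_triangle x' x y
  simp only [gromovProduct]; rw [dist_comm x' x] at h2; linarith

theorem FourPoint.le_or_le {δ : ℝ} (h : FourPoint S δ) (w x y z : S) :
    gromovProduct w x y ≤ gromovProduct w x z + δ ∨
      gromovProduct w y z ≤ gromovProduct w x z + δ :=
  min_le_iff.1 (h.2 w x y z)

theorem IsGeodesicSegment.dist_add {x y p : S} {A : Set S} (h : IsGeodesicSegment x y A)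
    (hp : p ∈ A) : dist x p + dist p y = dist x y := by
  obtain ⟨γ, h0, h1, hd, rfl⟩ := h
  obtain ⟨t, ht, rfl⟩ := hp
  have a := hd 0 ⟨le_rfl, dist_nonneg⟩ t ht
  have b := hd t ht (dist x y) ⟨dist_nonneg, le_rfl⟩
  rw [h0, zero_sub, abs_neg, abs_of_nonneg ht.1] at a
  rw [h1, abs_sub_comm, abs_of_nonneg (sub_nonneg.2 ht.2)] at b
  rw [a, b]; ring

theorem gromovProduct_le_dist_of_add {w x y q : S} (h : dist x q + dist q y = dist x y) :
    gromovProduct w x y ≤ dist w q := by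
  have h1 := dist_triangle x q w
  have h2 := dist_triangle y q w
  rw [dist_comm y q] at h2
  simp only [gromovProduct, dist_comm w q]; linarith

/-- Follow the side from `x` until it leaves the `δ`-neighbourhood of `C` for good; just beyond,
slimness puts it near `B`. The supremum of times need not be attained, so times within `1` on either
side of it are used, whence the extra `2`. -/
theorem IsGeodesicSegment.exists_near_both {δ : ℝ} (hδ : 0 ≤ δ) {x y : S} {A B C : Set S}
    (hA : IsGeodesicSegment x y A) (hxC : x ∈ C) (hyB : y ∈ B)
    (hslim : ∀ p ∈ A, ∃ q ∈ B ∪ C, dist p q ≤ δ) :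
    ∃ p ∈ A, (∃ q ∈ B, dist p q ≤ δ + 2) ∧ ∃ q ∈ C, dist p q ≤ δ + 2 := by
  obtain ⟨γ, h0, h1, hd, rfl⟩ := hA
  set T : Set ℝ := {t | t ∈ Icc 0 (dist x y) ∧ ∃ q ∈ C, dist (γ t) q ≤ δ}
  have hT0 : (0 : ℝ) ∈ T := ⟨⟨le_rfl, dist_nonneg⟩, x, hxC, by rw [h0]; simpa using hδ⟩
  have hTb : BddAbove T := ⟨dist x y, fun t ht => ht.1.2⟩
  obtain ⟨t₁, ht₁, hlt⟩ := exists_lt_of_lt_csSup ⟨0, hT0⟩ (sub_one_lt (sSup T))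
  have hle : t₁ ≤ sSup T := le_csSup hTb ht₁
  have hsL : sSup T ≤ dist x y := csSup_le ⟨0, hT0⟩ fun t ht => ht.1.2
  obtain ⟨q₁, hq₁, hd₁⟩ := ht₁.2
  have key : ∃ t₂ ∈ Icc 0 (dist x y), |t₁ - t₂| ≤ 2 ∧ ∃ q ∈ B, dist (γ t₂) q ≤ δ := by
    rcases eq_or_lt_of_le hsL with he | hl
    · refine ⟨dist x y, ⟨dist_nonneg, le_rfl⟩, ?_, y, hyB, by rw [h1]; simpa using hδ⟩
      rw [abs_le]; constructor <;> linarith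
    · set t₂ := min (sSup T + 1) (dist x y)
      have hgt : sSup T < t₂ := lt_min (lt_add_one _) hl
      have hle2 : t₂ ≤ sSup T + 1 := min_le_left _ _
      have hmem : t₂ ∈ Icc 0 (dist x y) := ⟨by linarith [ht₁.1.1], min_le_right _ _⟩
      refine ⟨t₂, hmem, by rw [abs_le]; constructor <;> linarith, ?_⟩
      obtain ⟨q, hq, hdq⟩ := hslim (γ t₂) (mem_image_of_mem γ hmem)
      rcases hq with hq | hq
      · exact ⟨q, hq, hdq⟩
      · exact absurd (le_csSup hTb (⟨hmem, q, hq, hdq⟩ : t₂ ∈ T)) (not_le.2 hgt)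
  obtain ⟨t₂, hm₂, habs, q₂, hq₂, hd₂⟩ := key
  refine ⟨γ t₁, mem_image_of_mem γ ht₁.1, ⟨q₂, hq₂, ?_⟩, q₁, hq₁, by linarith⟩
  have := dist_triangle (γ t₁) (γ t₂) q₂
  rw [hd t₁ ht₁.1 t₂ hm₂] at this
  linarith

theorem IsGeodesicSegment.left_mem {x y : S} {A : Set S} (h : IsGeodesicSegment x y A) :
    x ∈ A := by
  obtain ⟨γ, h0, h1, hd, rfl⟩ := h
  exact ⟨0, ⟨le_rfl, dist_nonneg⟩, h0⟩

theorem IsHyperbolic.exists_fourPoint (h : IsHyperbolic S) : ∃ δ, FourPoint S δ := by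
  obtain ⟨hg, δ, hδ, hs⟩ := h
  -- The point `p` of the side `x y` near both other sides satisfies `d(w, p) ≤ (x | y)_w + 2 (δ +
  -- 2)`. Slimness of the triangle with third vertex `z` costs one more `δ`.
  refine ⟨3 * δ + 4, by linarith, fun w x z y => ?_⟩
  obtain ⟨A, hA⟩ := hg x y
  obtain ⟨B, hB⟩ := hg y w
  obtain ⟨C, hC⟩ := hg x w
  obtain ⟨p, hp, ⟨q, hq, hpq⟩, q', hq', hpq'⟩ :=
    hA.exists_near_both hδ hC.left_mem hB.left_mem (hs x y w A B C hA hB hC)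
  have key : dist w p ≤ gromovProduct w x y + 2 * (δ + 2) := by
    have a1 := hB.dist_add hq
    have a2 := hC.dist_add hq'
    have a3 := hA.dist_add hp
    have b1 := dist_triangle p q w
    have b2 := dist_triangle p q' w
    have c1 := dist_triangle_right y p q
    have c2 := dist_triangle_right x p q'
    rw [dist_comm p y] at a3
    simp only [gromovProduct, dist_comm w p]
    linarith
  obtain ⟨B', hB'⟩ := hg y z
  obtain ⟨C', hC'⟩ := hg x z
  obtain ⟨r, hr, hpr⟩ := hs x y z A B' C' hA hB' hC' p hp
  have hwr := dist_triangle w p r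
  rcases hr with hr | hr
  · have := gromovProduct_le_dist_of_add (w := w) (hB'.dist_add hr)
    rw [gromovProduct_comm] at this
    exact (min_le_right _ _).trans (by linarith)
  · have := gromovProduct_le_dist_of_add (w := w) (hC'.dist_add hr)
    exact (min_le_left _ _).trans (by linarith)

end FourPoint

/-! ## Sequences converging at infinity -/

section Convergence

variable {S : Type v} [MetricSpace S]

/-- Gromov products are `1`-Lipschitz in the base point, so one base point suffices. -/
theorem ProductTendsto.of_base {x y : ℕ → S} (s : S)
    (h : ∀ B : ℝ, ∃ N : ℕ, ∀ n m, N ≤ n → N ≤ m → B ≤ gromovProduct s (x n) (y m)) :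
    ProductTendsto x y := by
  intro t
  rw [tendsto_atTop_atTop]
  intro B
  obtain ⟨N, hN⟩ := h (B + dist s t)
  refine ⟨(N, N), fun p hp => ?_⟩
  have := hN p.1 p.2 hp.1 hp.2
  have := gromovProduct_base_le s t (x p.1) (y p.2)
  linarith

theorem ProductTendsto.exists_le {x y : ℕ → S} (h : ProductTendsto x y) (s : S) (B : ℝ) :
    ∃ N : ℕ, ∀ n m, N ≤ n → N ≤ m → B ≤ gromovProduct s (x n) (y m) := by
  obtain ⟨⟨a, b⟩, hab⟩ := tendsto_atTop_atTop.1 (h s) B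
  exact ⟨max a b, fun n m hn hm => hab (n, m)
    ⟨(le_max_left _ _).trans hn, (le_max_right _ _).trans hm⟩⟩

theorem ProductTendsto.exists_lt_of_not {x y : ℕ → S} (h : ¬ ProductTendsto x y) (s : S) :
    ∃ B : ℝ, ∀ N : ℕ, ∃ n m, N ≤ n ∧ N ≤ m ∧ gromovProduct s (x n) (y m) < B := by
  by_contra! hc
  exact h (.of_base s hc)

theorem ProductTendsto.symm {x y : ℕ → S} (h : ProductTendsto x y) : ProductTendsto y x := by
  intro s
  refine ProductTendsto.of_base s (fun B => ?_) s
  obtain ⟨N, hN⟩ := h.exists_le s B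
  exact ⟨N, fun n m hn hm => by rw [gromovProduct_comm]; exact hN m n hm hn⟩

theorem ProductTendsto.trans {δ : ℝ} (hS : FourPoint S δ) {x y z : ℕ → S}
    (h : ProductTendsto x y) (h' : ProductTendsto y z) : ProductTendsto x z := by
  intro s
  refine ProductTendsto.of_base s (fun B => ?_) s
  obtain ⟨N, hN⟩ := h.exists_le s (B + δ)
  obtain ⟨M, hM⟩ := h'.exists_le s (B + δ)
  refine ⟨max N M, fun n m hn hm => ?_⟩
  have a := hN n (max N M) ((le_max_left _ _).trans hn) (le_max_left _ _)
  have b := hM (max N M) m (le_max_right _ _) ((le_max_right _ _).trans hm)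
  rcases hS.le_or_le s (x n) (y (max N M)) (z m) with h | h <;> linarith

theorem boundary_eq_iff {δ : ℝ} (hS : FourPoint S δ) {x y : ConvSeq S} :
    (Quot.mk _ x : GromovBoundary S) = Quot.mk _ y ↔ ProductTendsto x.1 y.1 := by
  have heq : Equivalence fun x y : ConvSeq S => ProductTendsto x.1 y.1 :=
    ⟨fun x => x.2, fun h => h.symm, fun h h' => h.trans hS h'⟩
  exact ⟨fun h => heq.eqvGen_iff.1 (Quot.eqvGen_exact h), fun h => Quot.sound h⟩

end Convergence

/-! ## Displacements -/

section Displacement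

variable {S : Type v} [MetricSpace S] {G : Type u} [Group G] [MulAction G S] [IsIsometricSMul G S]

theorem gromovProduct_smul (g : G) (s a b : S) :
    gromovProduct (g • s) (g • a) (g • b) = gromovProduct s a b := by
  simp only [gromovProduct, dist_smul]

theorem gromovProduct_smul_base (g : G) (s a b : S) :
    gromovProduct (g • s) a b = gromovProduct s (g⁻¹ • a) (g⁻¹ • b) := by
  rw [← gromovProduct_smul g s, smul_inv_smul, smul_inv_smul]

theorem dist_inv_smul (g : G) (s t : S) : dist s (g⁻¹ • t) = dist t (g • s) := by
  rw [← dist_smul g, smul_inv_smul, dist_comm]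

theorem dist_pow_smul_le (g : G) (s : S) (n : ℕ) : dist s (g ^ n • s) ≤ n * dist s (g • s) := by
  induction n with
  | zero => simp
  | succ n ih =>
    have h1 := dist_triangle s (g • s) (g ^ (n + 1) • s)
    rw [pow_succ', mul_smul, dist_smul] at h1
    rw [pow_succ', mul_smul]
    push_cast
    linarith

theorem dist_mul_smul_le (g h : G) (s : S) :
    dist s ((g * h) • s) ≤ dist s (g • s) + dist s (h • s) := by
  have := dist_triangle s (g • s) ((g * h) • s)
  rw [mul_smul] at this ⊢
  rwa [dist_smul] at this

theorem translationNumber_le [Nonempty S] (g : G) (s : S) :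
    translationNumber S g ≤ dist s (g • s) := by
  refine le_of_tendsto (tendsto_translationNumber S g s) ?_
  filter_upwards [eventually_gt_atTop 0] with n hn
  rw [div_le_iff₀ (by exact_mod_cast hn), mul_comm]
  exact dist_pow_smul_le g s n

theorem le_translationNumber [Nonempty S] {g : G} {s : S} {c : ℝ}
    (h : ∀ n : ℕ, n * c ≤ dist s (g ^ n • s)) : c ≤ translationNumber S g := by
  refine ge_of_tendsto (tendsto_translationNumber S g s) ?_
  filter_upwards [eventually_gt_atTop 0] with n hn
  rw [le_div_iff₀ (by exact_mod_cast hn), mul_comm]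
  exact h n

end Displacement

/-! ## Loxodromic elements -/

section Loxodromic

variable {S : Type v} [MetricSpace S] {G : Type u} [Group G] [MulAction G S] [IsIsometricSMul G S]

/-- The orbit `n ↦ hⁿ s` is a coarse line escaping to infinity in both directions. -/
structure Lox (h : G) (s : S) (C : ℝ) : Prop where
  product_le : ∀ m n : ℕ, gromovProduct s (h⁻¹ ^ m • s) (h ^ n • s) ≤ C
  escape : ∀ B : ℝ, ∃ N : ℕ, ∀ n, N ≤ n → B ≤ dist s (h ^ n • s)

theorem dist_inv_pow_smul (h : G) (s : S) (n : ℕ) :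
    dist s (h⁻¹ ^ n • s) = dist s (h ^ n • s) := by
  rw [inv_pow, dist_inv_smul]

namespace Lox

variable {h : G} {s : S} {C : ℝ}

theorem inv (H : Lox h s C) : Lox h⁻¹ s C where
  product_le m n := by rw [inv_inv, gromovProduct_comm]; exact H.product_le n m
  escape B := by simpa only [dist_inv_pow_smul] using H.escape B

/-- Translating by `h⁻ⁿ` turns the exchanged product at `hⁿ s` into `(h⁻ⁿ s | hᵏ s)_s ≤ C`. -/
theorem le_product (H : Lox h s C) (n k : ℕ) :
    dist s (h ^ n • s) - C ≤ gromovProduct s (h ^ n • s) (h ^ (n + k) • s) := by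
  have h1 := gromovProduct_add_swap s (h ^ n • s) (h ^ (n + k) • s)
  have h2 := H.product_le n k
  rw [gromovProduct_smul_base, ← mul_smul, pow_add, inv_mul_cancel_left, ← inv_pow] at h1
  rw [pow_add]
  linarith

theorem le_product_of_le (H : Lox h s C) {N n m : ℕ} {B : ℝ}
    (hN : ∀ n, N ≤ n → B ≤ dist s (h ^ n • s)) (hn : N ≤ n) (hm : N ≤ m) :
    B - C ≤ gromovProduct s (h ^ n • s) (h ^ m • s) := by
  rcases le_total n m with hnm | hnm
  · obtain ⟨k, rfl⟩ := Nat.exists_eq_add_of_le hnm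
    linarith [H.le_product n k, hN n hn]
  · obtain ⟨k, rfl⟩ := Nat.exists_eq_add_of_le hnm
    rw [gromovProduct_comm]
    linarith [H.le_product m k, hN m hm]

theorem productTendsto (H : Lox h s C) :
    ProductTendsto (fun n => h ^ n • s) (fun n => h ^ n • s) := by
  refine ProductTendsto.of_base s fun B => ?_
  obtain ⟨N, hN⟩ := H.escape (B + C)
  exact ⟨N, fun n m hn hm => by linarith [H.le_product_of_le hN hn hm]⟩

end Lox

/-- `h` moves `s` far and `(h s | h⁻¹ s)` is small in comparison. -/
def IsAxial (δ C : ℝ) (h : G) (s : S) : Prop :=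
  gromovProduct s (h⁻¹ • s) (h • s) ≤ C ∧ 2 * C + 4 * δ < dist s (h • s)

namespace IsAxial

variable {δ C : ℝ} {h : G} {s : S}

theorem inv (H : IsAxial δ C h s) : IsAxial δ C h⁻¹ s :=
  ⟨by rw [inv_inv, gromovProduct_comm]; exact H.1, by rw [dist_inv_smul]; exact H.2⟩

theorem swap (h : G) (s : S) (n : ℕ) : gromovProduct s (h • s) (h ^ (n + 1) • s) =
    dist s (h • s) - gromovProduct s (h⁻¹ • s) (h ^ n • s) := by
  have h1 := gromovProduct_add_swap s (h • s) (h ^ (n + 1) • s)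
  rw [gromovProduct_smul_base, ← mul_smul h⁻¹, pow_succ', inv_mul_cancel_left] at h1
  rw [pow_succ']
  linarith

/-- Local-to-global by induction: by `swap`, the bound for `n` makes `(h s | hⁿ⁺¹ s)` large, so
`hⁿ⁺¹ s` lies in the direction of `h s`, away from `h⁻¹ s`. The loss stays at one `δ` because each
step compares with `h s` directly. -/
theorem product_pow_le (hS : FourPoint S δ) (H : IsAxial δ C h s) (n : ℕ) :
    gromovProduct s (h⁻¹ • s) (h ^ n • s) ≤ C + δ := by
  have hC := (gromovProduct_nonneg _ _ _).trans H.1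
  have hδ := hS.1
  induction n with
  | zero => rw [pow_zero, one_smul, gromovProduct_self_right]; linarith
  | succ n ih =>
    have h1 := swap h s n
    have h2 := H.1
    have h3 := H.2
    have h4 := gromovProduct_comm s (h • s) (h ^ (n + 1) • s)
    rcases hS.le_or_le s (h⁻¹ • s) (h ^ (n + 1) • s) (h • s) with h | h <;> linarith

/-- As `d(s, hⁿ⁺¹ s) = d(h⁻¹ s, hⁿ s)`, the bounded product there means that each further power adds
a definite amount. -/
theorem mul_le_dist_pow (hS : FourPoint S δ) (H : IsAxial δ C h s) (n : ℕ) :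
    n * (dist s (h • s) - 2 * C - 2 * δ) ≤ dist s (h ^ n • s) := by
  induction n with
  | zero => simp
  | succ n ih =>
    have h1 := H.product_pow_le hS n
    have h2 : dist (h⁻¹ • s) (h ^ n • s) = dist s (h ^ (n + 1) • s) := by
      rw [← dist_smul h, smul_inv_smul, ← mul_smul, pow_succ']
    have h3 := dist_inv_smul h s s
    rw [gromovProduct, h2, dist_comm _ s, h3, dist_comm _ s] at h1
    push_cast
    linarith

theorem le_translationNumber [Nonempty S] (hS : FourPoint S δ) (H : IsAxial δ C h s) :
    dist s (h • s) - 2 * C - 2 * δ ≤ translationNumber S h :=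
  HypStr.le_translationNumber (H.mul_le_dist_pow hS)

theorem lox (hS : FourPoint S δ) (H : IsAxial δ C h s) : Lox h s (C + 2 * δ) where
  product_le m n := by
    have hC := (gromovProduct_nonneg _ _ _).trans H.1
    have hδ := hS.1
    cases m with
    | zero => rw [pow_zero, one_smul, gromovProduct_self_left]; linarith
    | succ m =>
      have h1 := swap h⁻¹ s m
      have h2 := H.inv.product_pow_le hS m
      have h3 := H.product_pow_le hS n
      have h4 := H.inv.2
      have h5 := gromovProduct_comm s (h⁻¹ • s) (h⁻¹ ^ (m + 1) • s)
      rcases hS.le_or_le s (h⁻¹ • s) (h⁻¹ ^ (m + 1) • s) (h ^ n • s) with h | h <;> linarith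
  escape B := by
    have hpos : 0 < dist s (h • s) - 2 * C - 2 * δ := by linarith [H.2, hS.1]
    obtain ⟨N, hN⟩ := exists_nat_ge (B / (dist s (h • s) - 2 * C - 2 * δ))
    refine ⟨N, fun n hn => le_trans ?_ (H.mul_le_dist_pow hS n)⟩
    rw [div_le_iff₀ hpos] at hN
    refine hN.trans ?_
    have : (N : ℝ) ≤ n := by exact_mod_cast hn
    gcongr

end IsAxial

/-- Chain through `y, a y, …, aʲ y`: translating a link back moves the base point by at most `j d(s,
a s)`. -/
theorem le_product_pow {δ : ℝ} (hS : FourPoint S δ) (a : G) (s y : S) (j : ℕ) :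
    gromovProduct s y (a • y) - j * (dist s (a • s) + δ) ≤ gromovProduct s y (a ^ j • y) := by
  have hδ := hS.1
  induction j with
  | zero =>
    have h1 := gromovProduct_le_left s y (a • y)
    have h2 : gromovProduct s y y = dist s y := by simp [gromovProduct, dist_comm]
    simp only [pow_zero, one_smul, Nat.cast_zero]
    linarith
  | succ j ih =>
    push_cast
    have hd := dist_nonneg (x := s) (y := a • s)
    rcases hS.le_or_le s y (a ^ j • y) (a ^ (j + 1) • y) with h | h
    · linarith
    · have h1 := gromovProduct_base_le s (a ^ j • s) y (a • y)
      have h2 := dist_pow_smul_le a s j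
      have h3 := gromovProduct_smul (a ^ j) (a⁻¹ ^ j • s) y (a • y)
      have h4 := gromovProduct_base_le s (a⁻¹ ^ j • s) y (a • y)
      rw [dist_inv_pow_smul] at h4
      rw [inv_pow, smul_inv_smul, ← mul_smul, ← pow_succ] at h3
      rw [inv_pow] at h4
      nlinarith

/-- A point whose displacement under a power of `h` is small, as seen from `s`, is close to one of
the two endpoints of `h`. -/
theorem Lox.near_endpoint {δ C : ℝ} {h : G} {s : S} (hS : FourPoint S δ) (H : Lox h s C) {k : ℕ}
    (hk : 0 < k) (A : ℝ) : ∃ (K : ℝ) (N : ℕ), ∀ y : S, K ≤ gromovProduct s y (h ^ k • y) →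
      (∀ n, N ≤ n → A ≤ gromovProduct s y (h ^ n • s)) ∨
      (∀ n, N ≤ n → A ≤ gromovProduct s y (h⁻¹ ^ n • s)) := by
  have hδ := hS.1
  obtain ⟨N, hN⟩ := H.escape (max (2 * A + 4 * δ) (A + C + 2 * δ) + 1)
  -- The points `gⁿ s` with `n ≥ N` all lie in one direction, so being away from one of them means
  -- being away from all.
  have far : ∀ {g : G}, Lox g s C →
      (∀ n, N ≤ n → max (2 * A + 4 * δ) (A + C + 2 * δ) + 1 ≤ dist s (g ^ n • s)) →
      ∀ y : S, (∃ n, N ≤ n ∧ gromovProduct s y (g ^ n • s) < A) →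
        ∀ n, N ≤ n → gromovProduct s y (g ^ n • s) ≤ A + δ := by
    rintro g Hg hg y ⟨m, hm, hlt⟩ n hn
    have h1 := Hg.le_product_of_le hg hn hm
    have h2 := le_max_right (2 * A + 4 * δ) (A + C + 2 * δ)
    rcases hS.le_or_le s y (g ^ n • s) (g ^ m • s) with h | h <;> linarith
  refine ⟨A + 2 * δ + N * (dist s (h ^ k • s) + δ) + 1, N, fun y hy => ?_⟩
  by_contra! hc
  -- The exponent `k * N` is both at least `N` and a multiple of `k`. Since `y` is away from the
  -- repelling end, this power pushes it towards the attracting end; but it also nearly preserves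
  -- the direction of `y`, so `y` was already near that end.
  have f1 := far H hN y hc.1 (k * N) (Nat.le_mul_of_pos_left N hk)
  have f2 := far H.inv (by simpa only [dist_inv_pow_smul] using hN) y hc.2 (k * N)
    (Nat.le_mul_of_pos_left N hk)
  have h1 := le_product_pow hS (h ^ k) s y N
  rw [← pow_mul] at h1
  have h2 := gromovProduct_add_swap s (h ^ (k * N) • s) (h ^ (k * N) • y)
  rw [gromovProduct_smul_base, inv_smul_smul, ← inv_pow,
    gromovProduct_comm _ (h⁻¹ ^ (k * N) • s)] at h2
  have h3 := hN (k * N) (Nat.le_mul_of_pos_left N hk)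
  have h4 := le_max_left (2 * A + 4 * δ) (A + C + 2 * δ)
  have h5 := gromovProduct_comm s (h ^ (k * N) • s) (h ^ (k * N) • y)
  rcases hS.le_or_le s y (h ^ (k * N) • y) (h ^ (k * N) • s) with h | h <;> linarith

variable (G) in
-- Seen from the midpoint of a long geodesic, its ends give `a, b` with long displacements in
-- different directions. If neither is axial, `a⁻¹ s` points like `a s` and `b⁻¹ s` like `b s`; then
-- `a * b` is axial.
theorem exists_lox {δ : ℝ} (hS : FourPoint S δ) (hgeo : ∀ x y : S, ∃ A, IsGeodesicSegment x y A)
    (s : S) {D : ℝ} (hD : ∀ x : S, ∃ g : G, dist x (g • s) ≤ D)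
    (hub : ∀ B : ℝ, ∃ x : S, B < dist s x) : ∃ (h : G) (C : ℝ), Lox h s C := by
  have hδ := hS.1
  obtain ⟨g₀, hg₀⟩ := hD s
  have hD0 : 0 ≤ D := dist_nonneg.trans hg₀
  -- `2 * D` bounds `(a s | b s)_s`; three four-point steps lead from it to the bound for `a * b`.
  set C := 2 * D + 3 * δ with hC
  obtain ⟨x, hx⟩ := hub (2 * (2 * C + 4 * δ + 4 * D + 1) + 2 * C)
  obtain ⟨_, γ, h0, h1, hd, -⟩ := hgeo s x
  have hm1 := hd 0 ⟨le_rfl, dist_nonneg⟩ (dist s x / 2) ⟨by positivity, by linarith⟩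
  have hm2 := hd (dist s x / 2) ⟨by positivity, by linarith⟩ (dist s x) ⟨dist_nonneg, le_rfl⟩
  rw [h0, abs_sub_comm, abs_of_nonneg (by linarith)] at hm1
  rw [h1, abs_sub_comm, abs_of_nonneg (by linarith)] at hm2
  set m := γ (dist s x / 2)
  obtain ⟨p, hp⟩ := hD m
  obtain ⟨q, hq⟩ := hD x
  have ha : dist s (p⁻¹ • s) = dist s (p • s) := dist_inv_smul p s s
  have hb : dist s ((p⁻¹ * q) • s) = dist (p • s) (q • s) := by
    rw [mul_smul, ← dist_smul p s, smul_inv_smul]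
  have hab : dist (p⁻¹ • s) ((p⁻¹ * q) • s) = dist s (q • s) := by
    rw [mul_smul, dist_smul]
  have t1 := dist_triangle s (p • s) m
  have t1' := dist_triangle s m (p • s)
  have t2 := dist_triangle4 m (p • s) (q • s) x
  have t2' := dist_triangle4 (p • s) m x (q • s)
  have t3 := dist_triangle s (q • s) x
  rw [dist_comm (p • s) m] at t1 t2'
  rw [dist_comm (q • s) x] at t2 t3
  have hlow : gromovProduct s (p⁻¹ • s) ((p⁻¹ * q) • s) ≤ 2 * D := by
    rw [gromovProduct, dist_comm _ s, dist_comm _ s, ha, hb, hab]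
    linarith
  rw [← ha] at t1 t1'
  rw [← hb] at t2 t2'
  set a : G := p⁻¹
  set b : G := p⁻¹ * q
  clear_value a b
  have la : 2 * C + 4 * δ < dist s (a • s) := by linarith
  have lb : 2 * C + 4 * δ < dist s (b • s) := by linarith
  by_cases ca : gromovProduct s (a⁻¹ • s) (a • s) ≤ C
  · exact ⟨a, _, IsAxial.lox hS ⟨ca, la⟩⟩
  by_cases cb : gromovProduct s (b⁻¹ • s) (b • s) ≤ C
  · exact ⟨b, _, IsAxial.lox hS ⟨cb, lb⟩⟩
  push Not at ca cb
  have e1 : gromovProduct s (a⁻¹ • s) (b • s) ≤ 2 * D + δ := by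
    have := gromovProduct_comm s (a • s) (a⁻¹ • s)
    rcases hS.le_or_le s (a • s) (a⁻¹ • s) (b • s) with h | h <;> linarith
  have e2 : gromovProduct s (a • s) (b⁻¹ • s) ≤ 2 * D + δ := by
    rcases hS.le_or_le s (a • s) (b⁻¹ • s) (b • s) with h | h <;> linarith
  have e3 := gromovProduct_add_swap s (a • s) ((a * b) • s)
  rw [gromovProduct_smul_base, ← mul_smul a⁻¹, inv_mul_cancel_left] at e3
  have e4 := gromovProduct_add_swap s (b⁻¹ • s) ((a * b)⁻¹ • s)
  rw [gromovProduct_smul_base, inv_inv, ← mul_smul b, mul_inv_rev a b,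
    mul_inv_cancel_left, dist_inv_smul, gromovProduct_comm _ (b • s)] at e4
  have e5 : gromovProduct s ((a * b) • s) (b⁻¹ • s) ≤ 2 * D + 2 * δ := by
    rcases hS.le_or_le s (a • s) ((a * b) • s) (b⁻¹ • s) with h | h <;> linarith
  have e6 : gromovProduct s ((a * b)⁻¹ • s) ((a * b) • s) ≤ C := by
    rw [mul_inv_rev]
    have := gromovProduct_comm s (b⁻¹ • s) ((b⁻¹ * a⁻¹) • s)
    rw [gromovProduct_comm]
    rcases hS.le_or_le s ((a * b) • s) ((b⁻¹ * a⁻¹) • s) (b⁻¹ • s) with h | h <;> linarith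
  refine ⟨a * b, _, IsAxial.lox hS ⟨e6, ?_⟩⟩
  have e7 : dist (a⁻¹ • s) (b • s) = dist s ((a * b) • s) := by
    rw [← dist_smul a, smul_inv_smul, mul_smul]
  rw [gromovProduct, e7, dist_comm _ s, dist_comm _ s, dist_inv_smul] at e1
  linarith

end Loxodromic

/-! ## Fixed endpoints of loxodromic elements -/

section FixedEnds

variable {S : Type v} [MetricSpace S] {G : Type u} [Group G] [MulAction G S] [IsIsometricSMul G S]

/-- `g` fixes the attracting endpoint of `h`. -/
def FixesEnd (g h : G) (s : S) : Prop :=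
  ProductTendsto (fun n : ℕ => g • h ^ n • s) (fun n : ℕ => h ^ n • s)

theorem gromovProduct_smul_smul_le (f : G) (s x y : S) :
    gromovProduct s (f • x) (f • y) ≤ gromovProduct s x y + dist s (f • s) := by
  rw [← gromovProduct_smul f s x y]
  exact gromovProduct_base_le _ _ _ _

theorem le_gromovProduct_smul_smul (f : G) (s x y : S) :
    gromovProduct s x y - dist s (f • s) ≤ gromovProduct s (f • x) (f • y) := by
  have := gromovProduct_base_le (f • s) s (f • x) (f • y)
  rw [gromovProduct_smul, dist_comm] at this
  linarith

/-- An element fixing both endpoints of a loxodromic element acts as a coarse translation. -/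
theorem Lox.product_le_of_fixesEnd {δ C : ℝ} {h : G} {s : S} (hS : FourPoint S δ)
    (H : Lox h s C) {g : G} (hp : FixesEnd g h s) (hq : FixesEnd g h⁻¹ s)
    (hg : 2 * C + 8 * δ < dist s (g • s)) :
    gromovProduct s (g • s) (g⁻¹ • s) ≤ C + 5 * δ := by
  have hδ := hS.1
  have hC : 0 ≤ C := (gromovProduct_nonneg _ _ _).trans (H.product_le 0 0)
  -- If `g s` lies coarsely between `s` and a far point `p` whose direction `g` fixes, then `s` lies
  -- between `g⁻¹ s` and `p`. Hence `g s`, which points towards `p`, is opposite to `g⁻¹ s`.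
  have key : ∀ p : S, dist s (g • s) + C + 2 * δ + 1 ≤ gromovProduct (g • s) (g • p) p →
      gromovProduct (g • s) s p ≤ C + 3 * δ →
      gromovProduct s (g • s) (g⁻¹ • s) ≤ C + 5 * δ := by
    intro p h1 h2
    have a1 : gromovProduct s (g⁻¹ • s) p ≤ C + 4 * δ := by
      have e : gromovProduct s (g⁻¹ • s) p = gromovProduct (g • s) s (g • p) := by
        rw [← gromovProduct_smul g, smul_inv_smul]
      have b1 := gromovProduct_le_left (g • s) s (g • p)
      rw [dist_comm] at b1
      rw [e]
      rcases hS.le_or_le (g • s) s (g • p) p with h | h <;> linarith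
    have a2 := gromovProduct_add_swap s (g • s) p
    rw [gromovProduct_comm]
    rcases hS.le_or_le s (g⁻¹ • s) (g • s) p with h | h <;> linarith
  obtain ⟨N, hN⟩ := hp.exists_le (g • s) (dist s (g • s) + C + 2 * δ + 1)
  obtain ⟨M, hM⟩ := hq.exists_le (g • s) (dist s (g • s) + C + 2 * δ + 1)
  set n := max N M
  have kp := hN n n (le_max_left _ _) (le_max_left _ _)
  have kq := hM n n (le_max_right _ _) (le_max_right _ _)
  have h0 := H.product_le n n
  rw [← gromovProduct_smul g] at h0
  set p := h ^ n • s
  set q := h⁻¹ ^ n • s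
  have d0 := dist_nonneg (x := s) (y := g • s)
  -- Replacing `g q` by `q` and `g p` by `p` shows that `g s` lies coarsely between the two ends, so
  -- `s` is on the other side of it from at least one of them.
  have c1 : gromovProduct (g • s) q (g • p) ≤ C + δ := by
    rcases hS.le_or_le (g • s) (g • q) q (g • p) with h | h <;> linarith
  have c2 : gromovProduct (g • s) q p ≤ C + 2 * δ := by
    have := gromovProduct_comm (g • s) (g • p) p
    rcases hS.le_or_le (g • s) q p (g • p) with h | h <;> linarith
  rcases hS.le_or_le (g • s) q s p with h | h
  · rw [gromovProduct_comm _ q s] at h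
    exact key q kq (by linarith)
  · exact key p kp (by linarith)

/-- The conjugates `hⁿ f h⁻ⁿ` depend only on `n` modulo `k`, so `f` moves all the `h⁻ⁿ s` by a
bounded amount. -/
theorem Lox.fixesEnd_inv_of_commute {C : ℝ} {f h : G} {s : S} (H : Lox h s C) {k : ℕ} (hk : 0 < k)
    (hc : Commute (h ^ k) f) : FixesEnd f h⁻¹ s := by
  have hper : Function.Periodic (fun n : ℕ => dist s ((h ^ n * f * (h ^ n)⁻¹) • s)) k := by
    intro n
    have : h ^ (n + k) * f * (h ^ (n + k))⁻¹ = h ^ n * f * (h ^ n)⁻¹ := by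
      rw [pow_add, mul_assoc (h ^ n), hc.eq]
      group
    simp only [this]
  obtain ⟨D, hD⟩ : ∃ D, ∀ n : ℕ, dist s ((h ^ n * f * (h ^ n)⁻¹) • s) ≤ D := by
    refine ⟨∑ r ∈ Finset.range k, dist s ((h ^ r * f * (h ^ r)⁻¹) • s), fun n => ?_⟩
    rw [← hper.map_mod_nat n]
    exact Finset.single_le_sum (f := fun r => dist s ((h ^ r * f * (h ^ r)⁻¹) • s))
      (fun _ _ => dist_nonneg) (Finset.mem_range.2 (Nat.mod_lt n hk))
  refine ProductTendsto.of_base s fun B => ?_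
  obtain ⟨N, hN⟩ := H.inv.productTendsto.exists_le s (B + D)
  refine ⟨N, fun n m hn hm => ?_⟩
  have h1 := hN n m hn hm
  have h2 := gromovProduct_le_add_dist s (h⁻¹ ^ n • s) (f • h⁻¹ ^ n • s) (h⁻¹ ^ m • s)
  have h3 : dist (h⁻¹ ^ n • s) (f • h⁻¹ ^ n • s) = dist s ((h ^ n * f * (h ^ n)⁻¹) • s) := by
    rw [← dist_smul (h ^ n), inv_pow, smul_inv_smul, mul_smul, mul_smul]
  linarith [hD n]

/-- Fixing the attracting end, `f` moves every `hʲ s` by at most `E`. So all `h⁻ʲ f hʲ` move both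
`s` and a distant `hⁱ s` by at most `E`; by acylindricity two of them coincide, and `f` commutes
with a power of `h`. -/
theorem Lox.fixesEnd_inv_of_acylindrical {δ C : ℝ} {f h : G} {s : S} (hS : FourPoint S δ)
    (H : Lox h s C) (hac : IsAcylindrical G S) (hf : FixesEnd f h s) : FixesEnd f h⁻¹ s := by
  have hδ := hS.1
  set E := 3 * dist s (f • s) + 2 * C + 4 * δ with hE
  have hclose : ∀ j : ℕ, dist (f • h ^ j • s) (h ^ j • s) ≤ E := by
    intro j
    obtain ⟨N, hN⟩ := hf.exists_le s (dist s (h ^ j • s) + 1)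
    have h1 := hN (N + j) (N + j) (by omega) (by omega)
    have h2 := H.le_product j N
    rw [add_comm j N] at h2
    have h3 := le_gromovProduct_smul_smul f s (h ^ j • s) (h ^ (N + j) • s)
    have hC : 0 ≤ C := (gromovProduct_nonneg _ _ _).trans (H.product_le 0 0)
    have hd := dist_nonneg (x := s) (y := f • s)
    have h4 : dist s (h ^ j • s) - C - dist s (f • s) - δ ≤
        gromovProduct s (f • h ^ j • s) (h ^ (N + j) • s) := by
      rcases hS.le_or_le s (f • h ^ j • s) (f • h ^ (N + j) • s) (h ^ (N + j) • s) with h | h <;>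
        linarith
    have h5 : dist s (h ^ j • s) - C - dist s (f • s) - 2 * δ ≤
        gromovProduct s (f • h ^ j • s) (h ^ j • s) := by
      rw [gromovProduct_comm] at h2
      rcases hS.le_or_le s (f • h ^ j • s) (h ^ (N + j) • s) (h ^ j • s) with h | h <;> linarith
    have h6 := dist_triangle s (f • s) (f • h ^ j • s)
    rw [dist_smul] at h6
    rw [gromovProduct, dist_comm _ s, dist_comm _ s] at h5
    linarith
  obtain ⟨K, N, hKN⟩ := hac E
  obtain ⟨i, hi⟩ := H.escape K
  have hfin := hKN s (h ^ i • s) (hi i le_rfl)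
  set T : Set G := {g : G | dist s (g • s) ≤ E ∧ dist (h ^ i • s) (g • h ^ i • s) ≤ E}
  have hTfin : T.Finite := Set.finite_of_encard_le_coe hfin
  have hmem : ∀ j : ℕ, (h ^ j)⁻¹ * f * h ^ j ∈ T := by
    intro j
    constructor
    · have := hclose j
      rwa [← dist_smul (h ^ j)⁻¹, inv_smul_smul, dist_comm, ← mul_smul, ← mul_smul] at this
    · have := hclose (j + i)
      rwa [pow_add, mul_smul, ← dist_smul (h ^ j)⁻¹, inv_smul_smul, dist_comm, ← mul_smul f,
        ← mul_smul (h ^ j)⁻¹, ← mul_assoc] at this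
  obtain ⟨a, b, hab, heq⟩ : ∃ a b : ℕ, a < b ∧
      (h ^ a)⁻¹ * f * h ^ a = (h ^ b)⁻¹ * f * h ^ b := by
    by_contra! hc
    refine (Set.infinite_of_injective_forall_mem (f := fun j : ℕ => (h ^ j)⁻¹ * f * h ^ j)
      (fun a b heq => ?_) hmem) hTfin
    rcases lt_trichotomy a b with hlt | he | hlt
    · exact absurd heq (hc a b hlt)
    · exact he
    · exact absurd heq.symm (hc b a hlt)
  obtain ⟨k, rfl⟩ := Nat.exists_eq_add_of_le hab.le
  refine H.fixesEnd_inv_of_commute (k := k) (by omega) ?_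
  have h1 := congrArg (fun x => h ^ (a + k) * x * (h ^ a)⁻¹) heq
  simp only [pow_add] at h1
  have e1 : h ^ a * h ^ k * ((h ^ a)⁻¹ * f * h ^ a) * (h ^ a)⁻¹ = h ^ k * f := by
    rw [(Commute.refl h).pow_pow a k |>.eq]; group
  have e2 : h ^ a * h ^ k * ((h ^ a * h ^ k)⁻¹ * f * (h ^ a * h ^ k)) * (h ^ a)⁻¹ = f * h ^ k := by
    rw [(Commute.refl h).pow_pow a k |>.eq]; group
  rw [e1, e2] at h1
  exact h1

/-- Were the repelling end moved by `f`, its translates by `hʲ f` would be distinct limit points: a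
coincidence makes a power of `h` fix `f h⁻∞`, which must then be an endpoint of `h`. It is not
`h⁻∞`, nor `h⁺∞`, which `f` fixes. -/
theorem Lox.fixesEnd_inv_of_not_isQuasiParabolic {δ C : ℝ} {h : G} {s : S} (hS : FourPoint S δ)
    (H : Lox h s C) (hnq : ¬ IsQuasiParabolic G S) (hfix : ∀ g : G, FixesEnd g h s) (f : G) :
    FixesEnd f h⁻¹ s := by
  by_contra hf
  have conv : ∀ j : ℕ, ProductTendsto (fun i : ℕ => (h ^ j * f * h⁻¹ ^ i) • s)
      (fun i : ℕ => (h ^ j * f * h⁻¹ ^ i) • s) := by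
    intro j
    have := H.inv.productTendsto.smul (h ^ j * f)
    simpa only [← mul_smul] using this
  have disjoint : ∀ j k : ℕ, 0 < k → ¬ ProductTendsto (fun i : ℕ => (h ^ j * f * h⁻¹ ^ i) • s)
      (fun i : ℕ => (h ^ (j + k) * f * h⁻¹ ^ i) • s) := by
    intro j k hk hc
    have hc' : ProductTendsto (fun i : ℕ => f • h⁻¹ ^ i • s)
        (fun i : ℕ => h ^ k • f • h⁻¹ ^ i • s) := by
      have := hc.smul (h ^ j)⁻¹
      simpa only [mul_smul, pow_add, inv_smul_smul] using this
    obtain ⟨B, hB⟩ := ProductTendsto.exists_lt_of_not hf s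
    -- The first term excludes closeness to the repelling end, the second closeness to the
    -- attracting one.
    set A := max B (C + dist s (f • s) + δ + 1)
    have hA1 : B ≤ A := le_max_left _ _
    have hA2 : C + dist s (f • s) + δ + 1 ≤ A := le_max_right _ _
    obtain ⟨K, N, hKN⟩ := H.near_endpoint hS hk A
    obtain ⟨M, hM⟩ := hc'.exists_le s K
    obtain ⟨n, m, hn, hm, hlt⟩ := hB (max N M)
    have hnM : M ≤ n := (le_max_right _ _).trans hn
    rcases hKN _ (hM n n hnM hnM) with hp | hq
    · obtain ⟨P, hP⟩ := (hfix f).exists_le s A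
      have h1 := hp (max N P) (le_max_left _ _)
      have h2 := hP (max N P) (max N P) (le_max_right _ _) (le_max_right _ _)
      have h3 := gromovProduct_smul_smul_le f s (h⁻¹ ^ n • s) (h ^ max N P • s)
      have h4 := H.product_le n (max N P)
      rw [gromovProduct_comm] at h2
      rcases hS.le_or_le s (f • h⁻¹ ^ n • s) (h ^ max N P • s) (f • h ^ max N P • s)
        with h | h <;> linarith
    · have := hq m ((le_max_left _ _).trans hm)
      linarith
  refine hnq ⟨?_, Quot.mk _ ⟨fun n => h ^ n • s, H.productTendsto⟩,
    fun g => Quot.sound (hfix g)⟩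
  refine Set.infinite_of_injective_forall_mem
    (f := fun j : ℕ => (Quot.mk _ ⟨_, conv j⟩ : GromovBoundary S)) (fun a b hab => ?_)
    (fun j => ⟨s, fun i => h ^ j * f * h⁻¹ ^ i, conv j, rfl⟩)
  have hab' := (boundary_eq_iff hS).1 hab
  rcases lt_trichotomy a b with hlt | he | hlt
  · obtain ⟨k, rfl⟩ := Nat.exists_eq_add_of_le hlt.le
    exact absurd hab' (disjoint a k (by omega))
  · exact he
  · obtain ⟨k, rfl⟩ := Nat.exists_eq_add_of_le hlt.le
    exact absurd hab'.symm (disjoint b k (by omega))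

/-- Every loxodromic element with basepoint `s` whose attracting endpoint is fixed by the group has
its repelling endpoint fixed as well. -/
def FixesBothEnds (G : Type u) [Group G] [MulAction G S] (s : S) : Prop :=
  ∀ (h : G) (C : ℝ), Lox h s C → (∀ g : G, FixesEnd g h s) → ∀ g : G, FixesEnd g h⁻¹ s

theorem exists_finset_product_le {δ : ℝ} (hS : FourPoint S δ)
    (hgeo : ∀ x y : S, ∃ A, IsGeodesicSegment x y A) (s : S) {D : ℝ}
    (hD : ∀ x : S, ∃ g : G, dist x (g • s) ≤ D) (hfix : FixesBothEnds G s) :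
    ∃ (F : Finset G) (K L : ℝ), ∀ g : G, L < dist s (g • s) →
      ∃ f ∈ F, gromovProduct s (g • s) (f • g⁻¹ • s) ≤ K := by
  classical
  have hδ := hS.1
  by_cases hub : ∀ B : ℝ, ∃ x : S, B < dist s x
  swap
  · push Not at hub
    obtain ⟨B, hB⟩ := hub
    -- In a bounded space no displacement exceeds `L = B`, so the claim is vacuous.
    exact ⟨∅, 0, B, fun g hg => absurd hg (not_lt.2 (hB _))⟩
  obtain ⟨h, C, H⟩ := exists_lox G hS hgeo s hD hub
  have lineal : (∀ g : G, FixesEnd g h s) → (∀ g : G, FixesEnd g h⁻¹ s) →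
      ∃ (F : Finset G) (K L : ℝ), ∀ g : G, L < dist s (g • s) →
        ∃ f ∈ F, gromovProduct s (g • s) (f • g⁻¹ • s) ≤ K := fun h1 h2 =>
    ⟨{1}, C + 5 * δ, 2 * C + 8 * δ, fun g hg => ⟨1, Finset.mem_singleton_self _, by
      rw [one_smul]; exact H.product_le_of_fixesEnd hS (h1 g) (h2 g) hg⟩⟩
  by_cases hp : ∀ g : G, FixesEnd g h s
  · exact lineal hp (hfix h C H hp)
  by_cases hq : ∀ g : G, FixesEnd g h⁻¹ s
  · have := hfix h⁻¹ C H.inv hq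
    rw [inv_inv] at this
    exact lineal this hq
  push Not at hp hq
  obtain ⟨f₁, hf₁⟩ := hp
  obtain ⟨f₂, hf₂⟩ := hq
  obtain ⟨B₁, hB₁⟩ := ProductTendsto.exists_lt_of_not hf₁ s
  obtain ⟨B₂, hB₂⟩ := ProductTendsto.exists_lt_of_not hf₂ s
  set A := max (B₁ + dist s (f₁ • s)) (B₂ + dist s (f₂ • s)) + 2 * δ with hA
  obtain ⟨K, N, hKN⟩ := H.near_endpoint hS one_pos A
  refine ⟨{1, h, f₁, f₂}, max K A + 2 * δ, 0, fun g _ => ?_⟩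
  by_contra! hc
  set y := g⁻¹ • s
  have h1 := hc 1 (by simp)
  rw [one_smul] at h1
  -- Failure for `1` and for `f` puts both `y` and `f y` near `g s`, hence near each other.
  have near : ∀ f ∈ ({1, h, f₁, f₂} : Finset G), max K A + δ ≤ gromovProduct s y (f • y) := by
    intro f hf
    have h2 := hc f hf
    rw [gromovProduct_comm] at h1
    rcases hS.le_or_le s y (g • s) (f • y) with h | h <;> linarith
  -- The chain `f kⁿ s`, `f y`, `y`, `kᵐ s` has large consecutive products, so `f` almost fixes the
  -- end of `k` near `y`.
  have contra : ∀ (k f : G) (B : ℝ), B + dist s (f • s) + 2 * δ ≤ A →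
      f ∈ ({1, h, f₁, f₂} : Finset G) → (∀ n, N ≤ n → A ≤ gromovProduct s y (k ^ n • s)) →
      ∀ n m, N ≤ n → N ≤ m → ¬ gromovProduct s (f • k ^ n • s) (k ^ m • s) < B := by
    intro k f B hB hf hk n m hn hm hlt
    have a1 := le_gromovProduct_smul_smul f s y (k ^ n • s)
    have a2 := hk n hn
    have a3 := hk m hm
    have a4 := near f hf
    have a5 := le_max_right K A
    have a6 := dist_nonneg (x := s) (y := f • s)
    rw [gromovProduct_comm] at a4
    have a7 : B + δ ≤ gromovProduct s (f • k ^ n • s) y := by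
      have := gromovProduct_comm s (f • y) (f • k ^ n • s)
      rcases hS.le_or_le s (f • k ^ n • s) (f • y) y with h | h <;> linarith
    rcases hS.le_or_le s (f • k ^ n • s) y (k ^ m • s) with h | h <;> linarith
  have hm1 := le_max_left (B₁ + dist s (f₁ • s)) (B₂ + dist s (f₂ • s))
  have hm2 := le_max_right (B₁ + dist s (f₁ • s)) (B₂ + dist s (f₂ • s))
  have hK : K ≤ gromovProduct s y (h ^ 1 • y) := by
    rw [pow_one]
    linarith [near h (by simp), le_max_left K A]
  rcases hKN y hK with hk | hk
  · obtain ⟨n, m, hn, hm, hlt⟩ := hB₁ N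
    exact contra h f₁ B₁ (by linarith) (by simp) hk n m hn hm hlt
  · obtain ⟨n, m, hn, hm, hlt⟩ := hB₂ N
    exact contra h⁻¹ f₂ B₂ (by linarith) (by simp) hk n m hn hm hlt

/-- Up to multiplication by an element of a finite set, translation numbers are displacements. -/
theorem exists_finset_le_translationNumber [Nonempty S] {δ : ℝ} (hS : FourPoint S δ)
    (hgeo : ∀ x y : S, ∃ A, IsGeodesicSegment x y A) (s : S) {D : ℝ}
    (hD : ∀ x : S, ∃ g : G, dist x (g • s) ≤ D) (hfix : FixesBothEnds G s) :
    ∃ (F : Finset G) (M : ℝ), ∀ g : G, ∃ f ∈ F,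
      dist s (g • s) - M ≤ translationNumber S (g * f) := by
  classical
  have hδ := hS.1
  obtain ⟨F, K, L, hF⟩ := exists_finset_product_le hS hgeo s hD hfix
  set P := ∑ f ∈ F, dist s (f • s)
  -- The element `1` serves displacements up to this constant, where a nonnegative translation
  -- number is enough. Beyond it, `g * f⁻¹` is axial with constant `K + P`, as `f⁻¹` moves `g s` by
  -- at most `P`.
  refine ⟨insert 1 (F.image (·⁻¹)), max L (P + 2 * (K + P) + 4 * δ), fun g => ?_⟩
  by_cases hg : dist s (g • s) ≤ max L (P + 2 * (K + P) + 4 * δ)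
  · refine ⟨1, Finset.mem_insert_self _ _, ?_⟩
    have : 0 ≤ translationNumber S (g * 1) :=
      le_translationNumber (s := s) fun n => by rw [mul_zero]; exact dist_nonneg
    linarith
  push Not at hg
  have g1 := (le_max_left _ _).trans_lt hg
  have g2 := (le_max_right _ _).trans_lt hg
  obtain ⟨f, hf, hle⟩ := hF g g1
  have hfP : dist s (f • s) ≤ P :=
    Finset.single_le_sum (f := fun f => dist s (f • s)) (fun _ _ => dist_nonneg) hf
  refine ⟨f⁻¹, Finset.mem_insert_of_mem (Finset.mem_image_of_mem _ hf), ?_⟩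
  have e1 : dist (g • s) ((g * f⁻¹) • s) = dist s (f • s) := by
    rw [mul_smul, dist_smul, dist_inv_smul]
  have e2 := dist_triangle_right s (g • s) ((g * f⁻¹) • s)
  have e3 := gromovProduct_le_add_dist s ((g * f⁻¹) • s) (g • s) (f • g⁻¹ • s)
  rw [dist_comm ((g * f⁻¹) • s), e1] at e3
  have hax : IsAxial δ (K + P) (g * f⁻¹) s := by
    refine ⟨?_, by linarith⟩
    rw [mul_inv_rev, inv_inv, mul_smul f, gromovProduct_comm]
    linarith
  have := hax.le_translationNumber hS
  have := le_max_right L (P + 2 * (K + P) + 4 * δ)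
  linarith

end FixedEnds

/-! ## Isospectral actions and equivalent actions -/

section Equivalence

variable {G : Type u} [Group G] {R : Type v} [MetricSpace R] [MulAction G R]
  {S : Type w} [MetricSpace S] [MulAction G S]

theorem AreEquivalent.exists_linear (h : AreEquivalent G R S) (r : R) : ∃ (s : S) (a : ℝ), 0 < a ∧
    (∀ g : G, dist s (g • s) ≤ a * dist r (g • r) + a) ∧
    ∀ g : G, dist r (g • r) ≤ a * dist s (g • s) + a := by
  obtain ⟨f, ⟨C, hC, hq, -⟩, he⟩ := h
  obtain ⟨E, hE⟩ := he r
  have hE' : ∀ g : G, dist (f (g • r)) (g • f r) ≤ E := fun g => hE ⟨g, rfl⟩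
  have hE0 : 0 ≤ E := dist_nonneg.trans (hE' 1)
  refine ⟨f r, C + E + C * (C + E), by positivity, fun g => ?_, fun g => ?_⟩
  · have h1 := (hq r (g • r)).2
    have h2 := dist_triangle (f r) (f (g • r)) (g • f r)
    have h3 := hE' g
    have h4 : 0 ≤ C * (C + E) := by positivity
    have h5 : 0 ≤ (E + C * (C + E)) * dist r (g • r) := by positivity
    linarith
  · have h1 := (hq r (g • r)).1
    have h2 := dist_triangle_right (f r) (f (g • r)) (g • f r)
    have h3 := hE' g
    rw [one_div, sub_le_iff_le_add, inv_mul_le_iff₀ hC] at h1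
    have h4 : 0 ≤ C * (C + E) := by positivity
    have h5 : 0 ≤ (E + C * (C + E)) * dist (f r) (g • f r) := by positivity
    have h6 : C * (dist (f r) (f (g • r)) + C) ≤ C * (dist (f r) (g • f r) + (C + E)) :=
      mul_le_mul_of_nonneg_left (by linarith) hC.le
    linarith

variable [IsIsometricSMul G R]

/-- The only use of isospectrality: in a sequence of counterexamples, correction by `F` changes
displacements in `R` by a bounded amount but makes translation numbers in `S` diverge. -/
theorem AreCoarselyIsospectral.exists_dist_smul_le [Nonempty R] [Nonempty S]
    (h : AreCoarselyIsospectral G R S) (r : R) (s : S) {F : Finset G} {M : ℝ}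
    (hF : ∀ g : G, ∃ f ∈ F, dist s (g • s) - M ≤ translationNumber S (g * f)) (C : ℝ) :
    ∃ D : ℝ, ∀ g : G, dist r (g • r) ≤ C → dist s (g • s) ≤ D := by
  by_contra! hc
  choose g hgR hgS using fun i : ℕ => hc i
  choose f hf hfM using fun i => hF (g i)
  have hS : Tendsto (fun i => translationNumber S (g i * f i)) atTop atTop := by
    refine tendsto_atTop_mono (f := fun i : ℕ => (i : ℝ) + -M) (fun i => ?_)
      (tendsto_atTop_add_const_right _ _ tendsto_natCast_atTop_atTop)
    linarith [hgS i, hfM i]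
  have hR := (h fun i => g i * f i).2 hS
  obtain ⟨i, hi⟩ := (hR.eventually_gt_atTop (C + ∑ f ∈ F, dist r (f • r))).exists
  have h1 := translationNumber_le (S := R) (g i * f i) r
  have h2 := dist_mul_smul_le (g i) (f i) r
  have h3 : dist r (f i • r) ≤ ∑ f ∈ F, dist r (f • r) :=
    Finset.single_le_sum (f := fun f => dist r (f • r)) (fun _ _ => dist_nonneg) (hf i)
  linarith [hgR i]

variable [IsIsometricSMul G S]

theorem IsCobounded.exists_dist_le (h : IsCobounded G S) (s : S) :
    ∃ D : ℝ, ∀ x : S, ∃ g : G, dist x (g • s) ≤ D := by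
  obtain ⟨B, hB, hcov⟩ := h
  obtain ⟨D, hD⟩ := hB.subset_closedBall s
  refine ⟨D, fun x => ?_⟩
  obtain ⟨g, b, hb, rfl⟩ := mem_iUnion.1 (hcov.ge (mem_univ x))
  exact ⟨g, by simpa using hD hb⟩

theorem dist_smul_smul_eq (g h : G) (s : S) : dist (g • s) (h • s) = dist s ((g⁻¹ * h) • s) := by
  rw [mul_smul, ← dist_smul g s, smul_inv_smul]

theorem exists_dist_smul_le_linear (hgeo : ∀ x y : R, ∃ A, IsGeodesicSegment x y A) (r : R) (s : S)
    {D : ℝ} (hD : ∀ x : R, ∃ g : G, dist x (g • r) ≤ D)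
    (h : ∀ C : ℝ, ∃ D : ℝ, ∀ g : G, dist r (g • r) ≤ C → dist s (g • s) ≤ D) :
    ∃ a : ℝ, 0 ≤ a ∧ ∀ g : G, dist s (g • s) ≤ a * dist r (g • r) + a := by
  obtain ⟨g₀, hg₀⟩ := hD r
  have hD0 : 0 ≤ D := dist_nonneg.trans hg₀
  obtain ⟨E, hE⟩ := h (1 + 2 * D)
  have hE0 : 0 ≤ E := dist_nonneg.trans (hE 1 (by rw [one_smul, dist_self]; linarith))
  refine ⟨2 * E, by linarith, fun g => ?_⟩
  obtain ⟨_, γ, h0, h1, hd, -⟩ := hgeo r (g • r)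
  set l := dist r (g • r)
  have hl : 0 ≤ l := dist_nonneg
  -- Orbit points near consecutive unit-spaced points of the geodesic differ by elements of
  -- displacement at most `1 + 2 * D`, each costing `E` in `S`; `min` stops the walk at the far end.
  have chain : ∀ (k : ℕ) (f : G), dist (γ (min k l)) (f • r) ≤ D →
      dist s (f • s) ≤ (k + 1) * E := by
    intro k
    induction k with
    | zero =>
      intro f hf
      rw [Nat.cast_zero, min_eq_left hl, h0] at hf
      simpa using hE f (by linarith)
    | succ k ih =>
      intro f hf
      obtain ⟨f', hf'⟩ := hD (γ (min k l))
      have a1 := ih f' hf'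
      have a2 : dist (γ (min k l)) (γ (min (k + 1 : ℕ) l)) ≤ 1 := by
        rw [hd _ ⟨le_min (Nat.cast_nonneg _) hl, min_le_right _ _⟩ _
          ⟨le_min (Nat.cast_nonneg _) hl, min_le_right _ _⟩]
        refine (abs_min_sub_min_le_max _ _ _ _).trans ?_
        simp
      have a3 := dist_triangle4 (f' • r) (γ (min k l)) (γ (min (k + 1 : ℕ) l)) (f • r)
      rw [dist_comm (f' • r) (γ _), dist_smul_smul_eq] at a3
      have a4 := hE (f'⁻¹ * f) (by linarith)
      have a5 := dist_mul_smul_le f' (f'⁻¹ * f) s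
      rw [mul_inv_cancel_left] at a5
      push_cast
      linarith
  have h2 := chain ⌈l⌉₊ g (by rw [min_eq_right (Nat.le_ceil l), h1, dist_self]; exact hD0)
  have h3 := Nat.ceil_lt_add_one hl
  calc dist s (g • s) ≤ (⌈l⌉₊ + 1) * E := h2
    _ ≤ (2 * l + 2) * E := mul_le_mul_of_nonneg_right (by linarith) hE0
    _ = 2 * E * l + 2 * E := by ring

theorem areEquivalent_of_linear (r : R) (s : S) {D D' a b : ℝ}
    (hD : ∀ x : R, ∃ g : G, dist x (g • r) ≤ D) (hD' : ∀ x : S, ∃ g : G, dist x (g • s) ≤ D')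
    (ha : 0 ≤ a) (hb : 0 ≤ b) (hab : ∀ g : G, dist s (g • s) ≤ a * dist r (g • r) + a)
    (hba : ∀ g : G, dist r (g • r) ≤ b * dist s (g • s) + b) : AreEquivalent G R S := by
  choose φ hφ using hD
  have hD0 : 0 ≤ D := dist_nonneg.trans (hφ r)
  obtain ⟨g₁, hg₁⟩ := hD' s
  have hD0' : 0 ≤ D' := dist_nonneg.trans hg₁
  have hab' : ∀ g h : G, dist (g • s) (h • s) ≤ a * dist (g • r) (h • r) + a := fun g h => by
    rw [dist_smul_smul_eq, dist_smul_smul_eq g h r]; exact hab _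
  have hba' : ∀ g h : G, dist (g • r) (h • r) ≤ b * dist (g • s) (h • s) + b := fun g h => by
    rw [dist_smul_smul_eq, dist_smul_smul_eq g h s]; exact hba _
  set C := max (max (2 * a * D + a) (a * D + a + D')) (a + b + 1 + (2 * D + b)) with hC
  have C1 : 2 * a * D + a ≤ C := (le_max_left _ _).trans (le_max_left _ _)
  have C2 : a * D + a + D' ≤ C := (le_max_right _ _).trans (le_max_left _ _)
  have C3 : a + b + 1 + (2 * D + b) ≤ C := le_max_right _ _
  have C4 : 1 ≤ C := by linarith
  -- Coarse equivariance holds because `φ (g x)` and `g φ x` both carry `r` to within `D` of `g x`.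
  refine ⟨fun x => φ x • s, ⟨C, by linarith, fun x y => ⟨?_, ?_⟩, fun y => ?_⟩, fun x => ?_⟩
  · have h1 := hba' (φ x) (φ y)
    have h2 := dist_triangle4 x (φ x • r) (φ y • r) y
    have h3 := hφ x
    have h4 := hφ y
    rw [dist_comm] at h4
    have h5 : b * dist (φ x • s) (φ y • s) ≤ C * dist (φ x • s) (φ y • s) := by
      gcongr; linarith
    rw [one_div, sub_le_iff_le_add, inv_mul_le_iff₀ (by linarith)]
    nlinarith
  · have h1 := hab' (φ x) (φ y)
    have h2 := dist_triangle4 (φ x • r) x y (φ y • r)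
    have h3 := hφ x
    have h4 := hφ y
    rw [dist_comm] at h3
    calc dist (φ x • s) (φ y • s) ≤ a * dist (φ x • r) (φ y • r) + a := h1
      _ ≤ a * (dist x y + 2 * D) + a := by gcongr; linarith
      _ = a * dist x y + (2 * a * D + a) := by ring
      _ ≤ C * dist x y + C := by gcongr; linarith
  · obtain ⟨g, hg⟩ := hD' y
    refine ⟨g • r, ?_⟩
    have h1 := hab' g (φ (g • r))
    have h2 := hφ (g • r)
    have h3 := dist_triangle y (g • s) (φ (g • r) • s)
    have h4 : a * dist (g • r) (φ (g • r) • r) ≤ a * D := by gcongr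
    linarith
  · refine ⟨2 * a * D + a, ?_⟩
    rintro _ ⟨g, rfl⟩
    have h1 := hab' (φ (g • x)) (g * φ x)
    have h2 := hφ (g • x)
    have h3 := hφ x
    have h4 := dist_triangle (φ (g • x) • r) (g • x) ((g * φ x) • r)
    rw [dist_comm (φ (g • x) • r) (g • x)] at h4
    rw [mul_smul g (φ x) r, dist_smul] at h4
    rw [mul_smul, mul_smul] at h1
    have h5 : a * dist (φ (g • x) • r) (g • φ x • r) ≤ a * (2 * D) := by gcongr; linarith
    simp only
    linarith

/-- Apply the bound to `gⁿ` and divide by `n`: the additive constant disappears. -/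
theorem translationNumber_le_mul [Nonempty R] [Nonempty S] {r : R} {s : S} {a : ℝ}
    (h : ∀ g : G, dist s (g • s) ≤ a * dist r (g • r) + a) (g : G) :
    translationNumber S g ≤ a * translationNumber R g := by
  have h1 := (tendsto_translationNumber R g r).const_mul a
  have h2 : Tendsto (fun n : ℕ => a * (dist r (g ^ n • r) / n) + a / n) atTop
      (𝓝 (a * translationNumber R g + 0)) := h1.add (tendsto_const_div_atTop_nhds_zero_nat a)
  rw [add_zero] at h2
  refine le_of_tendsto_of_tendsto (tendsto_translationNumber S g s) h2 ?_
  filter_upwards [eventually_gt_atTop 0] with n hn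
  rw [← mul_div_assoc, ← add_div]
  gcongr
  exact h _

theorem tendsto_translationNumber_of_linear [Nonempty R] [Nonempty S] {r : R} {s : S} {a : ℝ}
    (ha : 0 < a) (h : ∀ g : G, dist s (g • s) ≤ a * dist r (g • r) + a) {g : ℕ → G}
    (hg : Tendsto (fun i => translationNumber S (g i)) atTop atTop) :
    Tendsto (fun i => translationNumber R (g i)) atTop atTop := by
  refine tendsto_atTop_mono (fun i => ?_) (hg.const_mul_atTop (inv_pos.2 ha))
  rw [inv_mul_le_iff₀ ha]
  exact translationNumber_le_mul h (g i)

theorem AreEquivalent.areCoarselyIsospectral [Nonempty R] [Nonempty S]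
    (h : AreEquivalent G R S) : AreCoarselyIsospectral G R S := by
  obtain ⟨s, a, ha, h1, h2⟩ := h.exists_linear (Classical.arbitrary R)
  exact fun g => ⟨fun hg => tendsto_translationNumber_of_linear ha h2 hg,
    fun hg => tendsto_translationNumber_of_linear ha h1 hg⟩

theorem AreCoarselyIsospectral.areEquivalent [Nonempty R] [Nonempty S]
    (h : AreCoarselyIsospectral G R S) (hR : IsHyperbolic R) (hS : IsHyperbolic S)
    (cR : IsCobounded G R) (cS : IsCobounded G S)
    (fR : ∀ r : R, FixesBothEnds G r) (fS : ∀ s : S, FixesBothEnds G s) :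
    AreEquivalent G R S := by
  obtain ⟨δ, hδ⟩ := hR.exists_fourPoint
  obtain ⟨δ', hδ'⟩ := hS.exists_fourPoint
  have h' : AreCoarselyIsospectral G S R := fun g => (h g).symm
  set r : R := Classical.arbitrary R
  set s : S := Classical.arbitrary S
  obtain ⟨D, hD⟩ := cR.exists_dist_le r
  obtain ⟨D', hD'⟩ := cS.exists_dist_le s
  obtain ⟨F, M, hF⟩ := exists_finset_le_translationNumber hδ hR.1 r hD (fR r)
  obtain ⟨F', M', hF'⟩ := exists_finset_le_translationNumber hδ' hS.1 s hD' (fS s)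
  obtain ⟨a, ha, hab⟩ := exists_dist_smul_le_linear hR.1 r s hD (h.exists_dist_smul_le r s hF')
  obtain ⟨b, hb, hba⟩ := exists_dist_smul_le_linear hS.1 s r hD' (h'.exists_dist_smul_le s r hF)
  exact areEquivalent_of_linear r s hD hD' ha hb hab hba

theorem fixesBothEnds_of_not_isQuasiParabolic (hS : IsHyperbolic S) (h : ¬ IsQuasiParabolic G S)
    (s : S) : FixesBothEnds G s := by
  obtain ⟨δ, hδ⟩ := hS.exists_fourPoint
  exact fun _ _ H hfix f => H.fixesEnd_inv_of_not_isQuasiParabolic hδ h hfix f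

theorem fixesBothEnds_of_isAcylindrical (hS : IsHyperbolic S) (h : IsAcylindrical G S)
    (s : S) : FixesBothEnds G s := by
  obtain ⟨δ, hδ⟩ := hS.exists_fourPoint
  exact fun _ _ H hfix f => H.fixesEnd_inv_of_acylindrical hδ h (hfix f)

end Equivalence

/-! ## Cayley graphs -/

section CayleyGraphs

variable {G : Type u} [Group G]

open Classical in
/-- The vertex of the Cayley graph given by a group element. -/
noncomputable def CayleyGraph.vertex (X : GenSet G) (g : G) : CayleyGraph X :=
  ⟨Pi.single g 1, g, g, Or.inl rfl, left_mem_segment _ _ _⟩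

theorem CayleyGraph.smul_vertex (X : GenSet G) (a g : G) :
    a • vertex X g = vertex X (a * g) := by
  classical
  refine Realization.ext' (funext fun x => ?_)
  change (Pi.single g (1 : ℝ) : G → ℝ) (a⁻¹ * x) = (Pi.single (a * g) (1 : ℝ) : G → ℝ) x
  simp [Pi.single_apply, inv_mul_eq_iff_eq_mul]

theorem CayleyGraph.dist_le {X : GenSet G} {p q : CayleyGraph X} {c : ℝ}
    (h : PathLength X.graph (Realization.coord p) (Realization.coord q) c) : dist p q ≤ c :=
  csInf_le ⟨0, fun _ hr => PathLength.nonneg X.connected hr⟩ h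

open Classical in
theorem OnEdge.single {V : Type u} (Γ : SimpleGraph V) (u : V) : OnEdge Γ (Pi.single u 1) u u :=
  ⟨Or.inl rfl, left_mem_segment _ _ _⟩

open Classical in
theorem OnEdge.dist_le_of_single {V : Type u} {Γ : SimpleGraph V} {a u u' : V}
    (h : OnEdge Γ (Pi.single a 1) u u') : (Γ.dist a u : ℝ) ≤ 1 - (Pi.single a 1 : V → ℝ) u := by
  by_cases hu : a = u
  · subst hu; simp
  · have ha : a = u' := by
      by_contra hc
      have := h.spec.2.2.2.2.2.2 a hu hc
      simp at this
    subst ha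
    have hadj : Γ.Adj u a := h.1.resolve_left (Ne.symm hu)
    rw [SimpleGraph.dist_eq_one_iff_adj.2 hadj.symm, Pi.single_eq_of_ne (Ne.symm hu)]
    simp

/-- Standard paths may start by running to a neighbouring vertex, but the length paid there covers
the detour, so none beats the word metric. -/
theorem CayleyGraph.dist_vertex (X : GenSet G) (g h : G) :
    dist (vertex X g) (vertex X h) = X.wordDist g h := by
  classical
  have hg : Realization.coord (vertex X g) = Pi.single g (1 : ℝ) := by unfold vertex; congr!
  have hh : Realization.coord (vertex X h) = Pi.single h (1 : ℝ) := by unfold vertex; congr!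
  refine le_antisymm (dist_le ?_) (le_csInf (Realization.exists_pathLength _ _) ?_)
  · have := PathLength.via g g h h (OnEdge.single X.graph g) (OnEdge.single X.graph h)
    rw [hg, hh]
    convert this using 1
    simp [GenSet.wordDist]
  · intro r hr
    change PathLength X.graph (Realization.coord (vertex X g)) (Realization.coord (vertex X h)) r
      at hr
    rw [hg, hh] at hr
    have tri : ∀ u v : G, (X.wordDist g h : ℝ) ≤
        X.graph.dist g u + X.graph.dist u v + X.graph.dist h v := by
      intro u v
      have t1 := X.connected.dist_triangle (u := g) (v := u) (w := h)
      have t2 := X.connected.dist_triangle (u := u) (v := v) (w := h)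
      rw [SimpleGraph.dist_comm (u := v)] at t2
      unfold GenSet.wordDist
      exact_mod_cast (by omega)
    cases hr with
    | edge u v hp hq =>
      have t := tri u u
      rw [SimpleGraph.dist_self, Nat.cast_zero, add_zero] at t
      have a1 := OnEdge.dist_le_of_single hp
      have a2 := OnEdge.dist_le_of_single hq
      by_cases hgu : g = u
      · subst hgu
        rw [Pi.single_eq_same] at a1 ⊢
        linarith [le_abs_self (1 - (Pi.single h 1 : G → ℝ) g)]
      by_cases hhu : h = u
      · subst hhu
        rw [Pi.single_eq_same] at a2 ⊢
        linarith [neg_abs_le ((Pi.single g 1 : G → ℝ) h - 1)]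
      have eg : g = v := by
        by_contra hc
        have := hp.spec.2.2.2.2.2.2 g hgu hc
        simp at this
      have eh : h = v := by
        by_contra hc
        have := hq.spec.2.2.2.2.2.2 h hhu hc
        simp at this
      rw [eg, eh]
      simp [GenSet.wordDist]
    | via u u' v v' hp hq =>
      have a1 := OnEdge.dist_le_of_single hp
      have a2 := OnEdge.dist_le_of_single hq
      linarith [tri u v]

theorem CayleyGraph.isCobounded (X : GenSet G) : IsCobounded G (CayleyGraph X) := by
  classical
  refine ⟨Metric.closedBall (vertex X 1) 1, Metric.isBounded_closedBall, ?_⟩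
  rw [eq_univ_iff_forall]
  intro p
  obtain ⟨u, v, h⟩ := p.onEdge
  have hd : dist p (vertex X u) ≤ 1 := by
    have h1 := PathLength.via u v u u h (OnEdge.single X.graph u)
    have h2 : Realization.coord (vertex X u) = Pi.single u (1 : ℝ) := by unfold vertex; congr!
    rw [← h2] at h1
    refine (dist_le h1).trans ?_
    rw [h2, SimpleGraph.dist_self]
    simp [h.spec.1]
  refine mem_iUnion.2 ⟨u, u⁻¹ • p, ?_, by simp⟩
  rw [Metric.mem_closedBall, ← dist_smul u, smul_inv_smul, smul_vertex, mul_one]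
  exact hd

theorem CayleyGraph.dist_vertex_smul (X : GenSet G) (g : G) :
    dist (vertex X 1) (g • vertex X 1) = X.wordDist 1 g := by
  rw [smul_vertex, mul_one, dist_vertex]

theorem GenSet.Dominated.exists_linear {X Y : GenSet G} (h : X.Dominated Y) : ∃ a : ℝ, 0 < a ∧
    ∀ g : G, dist (CayleyGraph.vertex X 1) (g • CayleyGraph.vertex X 1) ≤
      a * dist (CayleyGraph.vertex Y 1) (g • CayleyGraph.vertex Y 1) + a := by
  obtain ⟨K, hK⟩ := h
  refine ⟨K + 1, by positivity, fun g => ?_⟩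
  rw [CayleyGraph.dist_vertex_smul, CayleyGraph.dist_vertex_smul]
  have : (X.wordDist 1 g : ℝ) ≤ K * Y.wordDist 1 g := by exact_mod_cast hK 1 g
  have : (0 : ℝ) ≤ Y.wordDist 1 g := Nat.cast_nonneg _
  have : (0 : ℝ) ≤ K := Nat.cast_nonneg _
  linarith

/-- Left invariance reduces to distances from `1`, and distinct elements are at distance at least
`1`, which absorbs the additive constant. -/
theorem GenSet.Dominated.of_linear {X Y : GenSet G} {a : ℝ}
    (h : ∀ g : G, (X.wordDist 1 g : ℝ) ≤ a * Y.wordDist 1 g + a) : X.Dominated Y := by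
  have ha : 0 ≤ a := by
    have := h 1
    simpa [GenSet.wordDist] using this
  refine ⟨2 * ⌈a⌉₊, fun g k => ?_⟩
  by_cases hgk : g = k
  · subst hgk; simp [GenSet.wordDist]
  have e : ∀ Z : GenSet G, Z.wordDist g k = Z.wordDist 1 (g⁻¹ * k) := fun Z => by
    have := Z.dist_mul g 1 (g⁻¹ * k)
    rwa [mul_one, mul_inv_cancel_left] at this
  have hpos : (1 : ℝ) ≤ Y.wordDist g k := by exact_mod_cast Y.connected.pos_dist_of_ne hgk
  have h1 := h (g⁻¹ * k)
  rw [← e, ← e] at h1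
  have h2 := Nat.le_ceil a
  have : (X.wordDist g k : ℝ) ≤ 2 * ⌈a⌉₊ * Y.wordDist g k := by
    calc (X.wordDist g k : ℝ) ≤ a * Y.wordDist g k + a * 1 := by linarith
      _ ≤ a * Y.wordDist g k + a * Y.wordDist g k := by gcongr
      _ = 2 * a * Y.wordDist g k := by ring
      _ ≤ _ := by gcongr
  exact_mod_cast this

theorem areCoarselyIsospectral_of_equiv {X Y : GenSet G} (h : X ≈ Y) :
    AreCoarselyIsospectral G (CayleyGraph X) (CayleyGraph Y) := by
  obtain ⟨a, ha, h1⟩ := GenSet.Dominated.exists_linear h.1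
  obtain ⟨b, hb, h2⟩ := GenSet.Dominated.exists_linear h.2
  exact fun g => ⟨fun hg => tendsto_translationNumber_of_linear ha h1 hg,
    fun hg => tendsto_translationNumber_of_linear hb h2 hg⟩

theorem AreEquivalent.genSet_equiv {X Y : GenSet G}
    (h : AreEquivalent G (CayleyGraph X) (CayleyGraph Y)) : X ≈ Y := by
  obtain ⟨s, a, ha, h1, h2⟩ := h.exists_linear (CayleyGraph.vertex X 1)
  set d := dist s (CayleyGraph.vertex Y 1)
  have hd : 0 ≤ d := dist_nonneg
  have c1 : ∀ g : G, dist s (g • s) ≤ Y.wordDist 1 g + 2 * d := fun g => by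
    have := dist_triangle4 s (CayleyGraph.vertex Y 1) (g • CayleyGraph.vertex Y 1) (g • s)
    rw [CayleyGraph.dist_vertex_smul, dist_smul, dist_comm _ s] at this
    linarith
  have c2 : ∀ g : G, (Y.wordDist 1 g : ℝ) ≤ dist s (g • s) + 2 * d := fun g => by
    have := dist_triangle4 (CayleyGraph.vertex Y 1) s (g • s) (g • CayleyGraph.vertex Y 1)
    rw [CayleyGraph.dist_vertex_smul, dist_smul, dist_comm _ s] at this
    linarith
  simp only [CayleyGraph.dist_vertex_smul] at h1 h2
  constructor
  · refine GenSet.Dominated.of_linear (a := a + 2 * a * d) fun g => ?_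
    have := mul_le_mul_of_nonneg_left (c1 g) ha.le
    have : 0 ≤ 2 * a * d * Y.wordDist 1 g := by positivity
    linarith [h2 g]
  · refine GenSet.Dominated.of_linear (a := a + 2 * d) fun g => ?_
    have : 0 ≤ 2 * d * X.wordDist 1 g := by positivity
    linarith [h1 g, c2 g]

theorem AreCoarselyIsospectral.toClass_eq {X Y X' Y' : GenSet G}
    (h : AreCoarselyIsospectral G (CayleyGraph X') (CayleyGraph Y'))
    (hX' : X'.toClass = X.toClass) (hY' : Y'.toClass = Y.toClass)
    (hX : IsHyperbolic (CayleyGraph X)) (aX : IsAcylindrical G (CayleyGraph X))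
    (hY : IsHyperbolic (CayleyGraph Y)) (aY : IsAcylindrical G (CayleyGraph Y)) :
    X.toClass = Y.toClass := by
  -- The representatives witnessing isospectrality may differ from the hyperbolic acylindrical ones;
  -- bi-Lipschitz invariance transfers it.
  have h1 := areCoarselyIsospectral_of_equiv (Quotient.exact hX')
  have h2 := areCoarselyIsospectral_of_equiv (Quotient.exact hY')
  have h3 : AreCoarselyIsospectral G (CayleyGraph X) (CayleyGraph Y) :=
    fun g => (h1 g).symm.trans ((h g).trans (h2 g))
  exact Quotient.sound (h3.areEquivalent hX hY (CayleyGraph.isCobounded X)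
    (CayleyGraph.isCobounded Y) (fixesBothEnds_of_isAcylindrical hX aX)
    (fixesBothEnds_of_isAcylindrical hY aY)).genSet_equiv

end CayleyGraphs

end HypStr

theorem mainTheorem10 {G : Type*} [Group G] :
    (∀ (R : Type*) [MetricSpace R] [Nonempty R] [MulAction G R] [IsIsometricSMul G R]
        (S : Type*) [MetricSpace S] [Nonempty S] [MulAction G S] [IsIsometricSMul G S],
        HypStr.IsHyperbolic R → HypStr.IsHyperbolic S →
        HypStr.IsCobounded G R → HypStr.IsCobounded G S →
        ¬ HypStr.IsQuasiParabolic G R → ¬ HypStr.IsQuasiParabolic G S →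
        (HypStr.AreCoarselyIsospectral G R S ↔ HypStr.AreEquivalent G R S)) ∧
    (∀ A ∈ HypStr.acylindricallyHyperbolicStructures G,
      ∀ B ∈ HypStr.acylindricallyHyperbolicStructures G,
        HypStr.GenClass.AreCoarselyIsospectral A B → A = B) := by
  refine ⟨?_, ?_⟩
  · intro R _ _ _ _ S _ _ _ _ hR hS cR cS qR qS
    exact ⟨fun h => h.areEquivalent hR hS cR cS
      (HypStr.fixesBothEnds_of_not_isQuasiParabolic hR qR)
      (HypStr.fixesBothEnds_of_not_isQuasiParabolic hS qS), fun h => h.areCoarselyIsospectral⟩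
  · rintro _ ⟨X, rfl, hX, aX⟩ _ ⟨Y, rfl, hY, aY⟩ ⟨X', Y', hX', hY', h⟩
    exact h.toClass_eq hX' hY' hX aX hY aY
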